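/- Let $\mathcal P_2(\mathbb R)$ be the set of Borel probability measures on $\mathbb R$ with finite second moment, with the Wasserstein distance $W_2$, and let $\mathcal P_2^r(\mathbb R)$ be the subset of Lebesgue absolutely continuous measures. Let $F(\rho)=\mathrm{KL}(\rho\,|\,N(0,1))\in[0,\infty]$. Let $\rho_0$ have density $p_0=\frac1{D_0}e^{-V_0}$, where $V_0(x)=\frac{x^2}{2}$ for $|x|<1$, $V_0(x)=|x|-\frac12$ for $|x|\ge 1$, and $D_0=\int_{\mathbb R}e^{-V_0(x)}\,dx$. For step sizes $h_k\in(0,1)$ consider the forward Euler iterates $$\rho_{k+1}=\Big(\mathrm{Id}-h_k\nabla\tfrac{\delta F}{\delta\rho}\Big|_{\rho_k}\Big)_\sharp\rho_k,\qquad k=0,1,2,\dots,$$ where the first variation $\frac{\delta F}{\delta\rho}|_{\rho}=\varphi$ is determined, $\rho$-a.e. and up to an additive constant, by $\frac{d}{d\varepsilon}\big|_{\varepsilon=0^+}F(\rho+\varepsilon(\sigma-\rho))=\int\varphi\,d(\sigma-\rho)$ for all probability measures $\sigma$ with bounded density with respect to $\rho$, and its gradient is taken $\rho$-a.e. Let $D(|\partial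 F|)$ be the set of $\rho\in\mathcal P_2(\mathbb R)$ with $F(\rho)<\infty$ and finite metric slope $|\partial F|(\rho)=\limsup_{W_2(\mu,\rho)\to0}\frac{(F(\rho)-F(\mu))^+}{W_2(\rho,\mu)}$. (i) $F$ is $1$-geodesically convex on $\mathcal P_2^r(\mathbb R)$: any $\mu,\nu\in\mathcal P_2^r(\mathbb R)$ are joined by an optimal plan for the quadratic cost, and for every such plan $\gamma$ and every $t\in[0,1]$, the measure $\mu_t=((1-t)x+ty)_\sharp\gamma$ satisfies $F(\mu_t)\le(1-t)F(\mu)+tF(\nu)-\frac12t(1-t)W_2^2(\mu,\nu)$. The unique minimizer of $F$ on $\mathcal P_2^r(\mathbb R)$ is $N(0,1)$, and the minimum value is $0$. (ii) For any step sizes $h_k\in(0,1)$, the iterates $\rho_k$ exist for all $k$. The measure $\rho_1$ has a density $p_1$ with jumps (distinct finite one-sided limits) at $1$ and at $-1$, so that no version of the density of $\rho_1$ is continuous at $1$ or at $-1$. Moreover $\rho_1\notin D(|\partial F|)$. (iii) For every $k\ge0$ there are constants $a_k,c_k\in[1,\infty)$ and $b_k\in\mathbb R$ such that $\rho_k$ has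 the density $$p_k(x)=\begin{cases}\frac1{D_0}e^{-x^2/2}, & x\in[0,1),\\ 0, & x\in[1,c_k),\\ e^{-a_kx+b_k}, & x\in[c_k,\infty),\\ p_k(-x), & x<0.\end{cases}$$ -/

import Mathlib

open MeasureTheory ProbabilityTheory InformationTheory Set Filter Topology
open scoped ENNReal

noncomputable section

namespace WassersteinEuler

/-- `𝒫₂(ℝ)`: Borel probability measures on the line with finite second moment. -/
def P2 : Set (Measure ℝ) :=
  {μ | IsProbabilityMeasure μ ∧ ∫⁻ x, ‖x‖ₑ ^ 2 ∂μ < ⊤}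

/-- `𝒫₂ʳ(ℝ)`: the Lebesgue absolutely continuous elements of `𝒫₂(ℝ)`. -/
def P2r : Set (Measure ℝ) :=
  {μ | μ ∈ P2 ∧ μ ≪ volume}

/-- Transport plans (couplings) between `μ` and `ν`. -/
def plans (μ ν : Measure ℝ) : Set (Measure (ℝ × ℝ)) :=
  {γ | γ.map Prod.fst = μ ∧ γ.map Prod.snd = ν}

/-- Quadratic transport cost of a plan. -/
def cost (γ : Measure (ℝ × ℝ)) : ℝ≥0∞ :=
  ∫⁻ z, edist z.1 z.2 ^ 2 ∂γ

/-- The Wasserstein distance `W₂`. -/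
def W2 (μ ν : Measure ℝ) : ℝ≥0∞ :=
  (⨅ γ ∈ plans μ ν, cost γ) ^ (1 / 2 : ℝ)

/-- `γ` is an optimal plan between `μ` and `ν`. -/
def IsOptimalPlan (μ ν : Measure ℝ) (γ : Measure (ℝ × ℝ)) : Prop :=
  γ ∈ plans μ ν ∧ ∀ γ' ∈ plans μ ν, cost γ ≤ cost γ'

/-- The point at time `t` of the displacement interpolation induced by a plan. -/
def interpolate (γ : Measure (ℝ × ℝ)) (t : ℝ) : Measure ℝ :=
  γ.map (fun z => (1 - t) * z.1 + t * z.2)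

/-- `lam`-convexity of `F` along Wasserstein geodesics with end points in `S`: any two elements
of `S` are joined by an optimal plan, and along the geodesic induced by every such plan `F` is
`lam`-convex. (The existence clause makes this imply both the version that asks for the inequality
along one geodesic and the version that asks for it along all of them.) -/
def GeodesicallyConvexOn (lam : ℝ) (F : Measure ℝ → ℝ≥0∞) (S : Set (Measure ℝ)) : Prop :=
  ∀ μ ∈ S, ∀ ν ∈ S, (∃ γ, IsOptimalPlan μ ν γ) ∧
    ∀ γ, IsOptimalPlan μ ν γ → ∀ t ∈ Icc (0 : ℝ) 1,
      (F (interpolate γ t) : EReal) ≤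
        ((1 - t : ℝ) : EReal) * (F μ : EReal) + ((t : ℝ) : EReal) * (F ν : EReal)
          - ((lam / 2 * t * (1 - t) : ℝ) : EReal) * ((W2 μ ν ^ 2 : ℝ≥0∞) : EReal)

/-- The metric slope `|∂F|(ρ) = limsup_{μ → ρ} (F(ρ) - F(μ))⁺ / W₂(ρ, μ)` in `(𝒫₂(ℝ), W₂)`
of a nonnegative functional, at a point where it is finite (subtraction in `ℝ≥0∞` is the
positive part). -/
def slope (F : Measure ℝ → ℝ≥0∞) (ρ : Measure ℝ) : ℝ≥0∞ :=
  ⨅ (r : ℝ≥0∞) (_ : 0 < r), ⨆ (μ : Measure ℝ) (_ : μ ∈ P2 ∧ μ ≠ ρ ∧ W2 ρ μ < r),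
    (F ρ - F μ) / W2 ρ μ

/-- `D(|∂F|)`: the points at which `F` and its metric slope are finite. -/
def slopeDomain (F : Measure ℝ → ℝ≥0∞) : Set (Measure ℝ) :=
  {ρ | ρ ∈ P2 ∧ F ρ ≠ ⊤ ∧ slope F ρ ≠ ⊤}

/-- `(1 - ε) ρ + ε σ`. -/
def mix (ρ σ : Measure ℝ) (ε : ℝ) : Measure ℝ :=
  ENNReal.ofReal (1 - ε) • ρ + ENNReal.ofReal ε • σ

/-- `φ` is a first variation `δF/δρ` of `F` at `ρ`: `d/dε F(ρ + ε (σ - ρ)) = ∫ φ d(σ - ρ)` at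
`ε = 0⁺` for all probability measures `σ` having a bounded density with respect to `ρ`.
This determines `φ` up to an additive constant `ρ`-almost everywhere; its values off the support
of `ρ` play no role in a push-forward of `ρ`. -/
def IsFirstVariation (F : Measure ℝ → ℝ≥0∞) (ρ : Measure ℝ) (φ : ℝ → ℝ) : Prop :=
  Integrable φ ρ ∧
    ∀ g : ℝ → ℝ≥0∞, Measurable g → (∃ C : ℝ≥0∞, C ≠ ⊤ ∧ ∀ x, g x ≤ C) → ∫⁻ x, g x ∂ρ = 1 →
      (∀ ε ∈ Icc (0 : ℝ) 1, F (mix ρ (ρ.withDensity g) ε) ≠ ⊤) ∧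
      HasDerivWithinAt (fun ε => (F (mix ρ (ρ.withDensity g) ε)).toReal)
        (∫ x, φ x ∂(ρ.withDensity g) - ∫ x, φ x ∂ρ) (Ici 0) 0

/-- `v = ∇ (δF/δρ)` at `ρ`, as a `ρ`-almost everywhere defined field. -/
def IsWassersteinGradient (F : Measure ℝ → ℝ≥0∞) (ρ : Measure ℝ) (v : ℝ → ℝ) : Prop :=
  AEMeasurable v ρ ∧
    ∃ φ : ℝ → ℝ, IsFirstVariation F ρ φ ∧ ∀ᵐ x ∂ρ, HasDerivAt φ (v x) x

/-- `ρ 0, ρ 1, …` are the forward Euler iterates `ρ (k+1) = (Id - h k ∇ (δF/δρ)|_{ρ k})_♯ ρ k`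
started from `init`. -/
def IsForwardEuler (F : Measure ℝ → ℝ≥0∞) (h : ℕ → ℝ) (init : Measure ℝ)
    (ρ : ℕ → Measure ℝ) : Prop :=
  ρ 0 = init ∧
    ∀ k, ∃ v : ℝ → ℝ, IsWassersteinGradient F (ρ k) v ∧
      ρ (k + 1) = (ρ k).map (fun x => x - h k * v x)

/-- `p` is a probability density function (a version of the Lebesgue density) of `ρ`. -/
def IsDensity (p : ℝ → ℝ) (ρ : Measure ℝ) : Prop :=
  Measurable p ∧ (∀ x, 0 ≤ p x) ∧ ρ = volume.withDensity (fun x => ENNReal.ofReal (p x))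

/-- `p` has a jump at `x`: finite one-sided limits that differ. -/
def HasJumpAt (p : ℝ → ℝ) (x : ℝ) : Prop :=
  ∃ l r : ℝ, Tendsto p (𝓝[<] x) (𝓝 l) ∧ Tendsto p (𝓝[>] x) (𝓝 r) ∧ l ≠ r

/-- The target `N(0,1)`. -/
def target : Measure ℝ := gaussianReal 0 1

/-- The energy `F = KL(· | N(0,1))`. -/
def energy (ρ : Measure ℝ) : ℝ≥0∞ := klDiv ρ target

/-- The initial potential. -/
def V0 (x : ℝ) : ℝ := if x ∈ Ioo (-1 : ℝ) 1 then x ^ 2 / 2 else |x| - 1 / 2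

/-- The normalization constant of `exp (-V0)`. -/
def D0 : ℝ := ∫ x, Real.exp (-V0 x)

/-- The initial density. -/
def p0 (x : ℝ) : ℝ := 1 / D0 * Real.exp (-V0 x)

/-- The initial measure. -/
def initial : Measure ℝ := volume.withDensity (fun x => ENNReal.ofReal (p0 x))

/-- The shape of the iterates on the half line `x ≥ 0`. -/
def halfShape (a b c x : ℝ) : ℝ :=
  if x < 1 then 1 / D0 * Real.exp (-x ^ 2 / 2)
  else if x < c then 0
  else Real.exp (-a * x + b)

/-- The even extension of `halfShape`. -/
def iterateShape (a b c x : ℝ) : ℝ :=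
  if 0 ≤ x then halfShape a b c x else halfShape a b c (-x)

end WassersteinEuler

end

open WassersteinEuler

/-! Convexity. On the line, exchanging the targets of two crossing trajectories lowers the quadratic
cost, so the support of an optimal plan is totally ordered. For 0 < t < 1 such a set is parametrized
by the intermediate point u = (1-t)x + ty through increasing Lipschitz functions x = X(u), y = Y(u)
with (1-t)X' + tY' = 1. The density q of the interpolant satisfies q ≤ (p_μ ∘ X) X' and q ≤ (p_ν ∘
Y) Y' almost everywhere; with log s ≤ s - 1 this gives log q ≤ (1-t) log p_μ(X) + t log p_ν(Y). The
Gaussian potential contributes the exact identity u² = (1-t)X² + tY² - t(1-t)(X-Y)², whose last term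
is the modulus of convexity (`energy_interpolate_le`).

Euler iterates. The first variation of the energy is the log-likelihood ratio log p + x²/2 + const
(`isFirstVariation_klDiv`), unique up to a constant, and its gradient is unique almost everywhere.
On the core |x| < 1 it is constant, so the core never moves. On the right tail log p is affine with
slope -a, so the velocity is x - a, and the step x ↦ (1-h)x + ha is affine and maps an exponential
tail to an exponential tail (`map_shapeMeasure`). The left tail follows by symmetry.

Irregularity. In the first step a = c = 1, so the tail still starts at 1, but it is compressed by
1-h while the core is unchanged: the log-density jumps upwards by J = -log(1-h) at 1. Moving a mass
M of order s from (1, 1+s) to (1-s, 1) lowers the energy by at least MJ/4 for small s, whereas the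
distance travelled in W₂ is at most 2s√M. The ratio is at least of order s^(-1/2), so the metric
slope is infinite (`shapeMeasure_notMem_slopeDomain`). -/

namespace WassersteinEuler

/-! ### Kullback-Leibler divergence under bounded changes of density -/

section KullbackLeibler

variable {α : Type*} {mα : MeasurableSpace α} {ρ τ : Measure α}

/-- Only an upper bound is needed: `klFun` is nonnegative, and with r the density it is at most 1 +
r|G|, which is integrable for the probability measure `τ`. -/
lemma integrable_llr_of_le [IsProbabilityMeasure ρ] [IsProbabilityMeasure τ] (hac : ρ ≪ τ)
    {G : α → ℝ} (hG : Integrable G ρ) (hle : ∀ᵐ x ∂ρ, llr ρ τ x ≤ G x) :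
    Integrable (llr ρ τ) ρ := by
  rw [← integrable_klFun_rnDeriv_iff hac]
  refine ⟨(measurable_klFun.comp (ρ.measurable_rnDeriv τ).ennreal_toReal).aestronglyMeasurable, ?_⟩
  have hle' : ∀ᵐ x ∂τ, ‖klFun (ρ.rnDeriv τ x).toReal‖ₑ
      ≤ 1 + ρ.rnDeriv τ x * ‖G x‖ₑ := by
    have h0 : ∀ᵐ x ∂τ, ρ.rnDeriv τ x ≠ 0 → llr ρ τ x ≤ G x := by
      have : ∀ᵐ x ∂(τ.withDensity (ρ.rnDeriv τ)), llr ρ τ x ≤ G x := by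
        rwa [Measure.withDensity_rnDeriv_eq _ _ hac]
      exact (ae_withDensity_iff (ρ.measurable_rnDeriv τ)).1 this
    filter_upwards [h0, ρ.rnDeriv_lt_top τ] with x hx hfin
    have hnn := klFun_nonneg (x := (ρ.rnDeriv τ x).toReal) ENNReal.toReal_nonneg
    rw [Real.enorm_eq_ofReal hnn]
    have hreal : klFun (ρ.rnDeriv τ x).toReal ≤ 1 + (ρ.rnDeriv τ x).toReal * |G x| := by
      rw [klFun_apply]
      by_cases h : ρ.rnDeriv τ x = 0
      · simp [h]
      · have h1 := hx h
        have h2 : (ρ.rnDeriv τ x).toReal * Real.log (ρ.rnDeriv τ x).toReal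
            ≤ (ρ.rnDeriv τ x).toReal * |G x| :=
          mul_le_mul_of_nonneg_left (h1.trans (le_abs_self _)) ENNReal.toReal_nonneg
        linarith [ENNReal.toReal_nonneg (a := ρ.rnDeriv τ x)]
    refine (ENNReal.ofReal_le_ofReal hreal).trans ?_
    rw [ENNReal.ofReal_add zero_le_one (by positivity), ENNReal.ofReal_one,
      ENNReal.ofReal_mul ENNReal.toReal_nonneg, ENNReal.ofReal_toReal hfin.ne,
      ← Real.enorm_eq_ofReal_abs]
  have hfin : ∫⁻ x, ρ.rnDeriv τ x * ‖G x‖ₑ ∂τ < ⊤ := by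
    have h1 : ∫⁻ x, ‖G x‖ₑ ∂(τ.withDensity (ρ.rnDeriv τ)) < ⊤ := by
      rw [Measure.withDensity_rnDeriv_eq _ _ hac]; exact hG.2
    rwa [lintegral_withDensity_eq_lintegral_mul₀' (ρ.measurable_rnDeriv τ).aemeasurable] at h1
    rw [Measure.withDensity_rnDeriv_eq _ _ hac]
    exact hG.aestronglyMeasurable.enorm
  refine (lintegral_mono_ae hle').trans_lt ?_
  rw [lintegral_add_left measurable_const]
  simp [hfin]

lemma toReal_klDiv_eq_integral_llr [IsProbabilityMeasure ρ] [IsProbabilityMeasure τ]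
    (hac : ρ ≪ τ) : (klDiv ρ τ).toReal = ∫ x, llr ρ τ x ∂ρ :=
  toReal_klDiv_of_measure_eq hac (by simp)

lemma llr_withDensity [IsProbabilityMeasure ρ] [IsProbabilityMeasure τ] (hac : ρ ≪ τ)
    {m : α → ℝ} (hm : Measurable m) :
    ∀ᵐ x ∂(ρ.withDensity fun x => ENNReal.ofReal (m x)),
      llr (ρ.withDensity fun x => ENNReal.ofReal (m x)) τ x = Real.log (m x) + llr ρ τ x := by
  have hmm : Measurable fun x => ENNReal.ofReal (m x) := hm.ennreal_ofReal
  rw [ae_withDensity_iff hmm]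
  have h1 := hac.ae_le (Measure.rnDeriv_withDensity_left_of_absolutelyContinuous hac
    hmm.aemeasurable)
  filter_upwards [h1, Measure.rnDeriv_pos hac, hac.ae_le (ρ.rnDeriv_lt_top τ)] with x hx hpos hlt h0
  have hm0 : 0 < m x := by simpa using h0
  rw [llr_def, llr_def]
  simp only [hx, ENNReal.toReal_mul, ENNReal.toReal_ofReal hm0.le]
  rw [Real.log_mul hm0.ne' (ENNReal.toReal_pos hpos.ne' hlt.ne).ne']

lemma isProbabilityMeasure_withDensity_ofReal [IsProbabilityMeasure ρ]
    {m : α → ℝ} (hm0 : ∀ x, 0 ≤ m x) (hint : Integrable m ρ) (h1 : ∫ x, m x ∂ρ = 1) :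
    IsProbabilityMeasure (ρ.withDensity fun x => ENNReal.ofReal (m x)) := by
  constructor
  rw [withDensity_apply _ MeasurableSet.univ, Measure.restrict_univ, ← ofReal_integral_eq_lintegral_ofReal hint (ae_of_all _ hm0), h1, ENNReal.ofReal_one]

lemma integral_withDensity_ofReal {m : α → ℝ} (hm : Measurable m) (hm0 : ∀ x, 0 ≤ m x)
    (f : α → ℝ) :
    ∫ x, f x ∂(ρ.withDensity fun x => ENNReal.ofReal (m x)) = ∫ x, m x * f x ∂ρ := by
  rw [integral_withDensity_eq_integral_toReal_smul hm.ennreal_ofReal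
    (ae_of_all _ fun _ => ENNReal.ofReal_lt_top)]
  refine integral_congr_ae (ae_of_all _ fun x => ?_)
  simp [ENNReal.toReal_ofReal (hm0 x)]

/-- The chain rule for the log-likelihood ratio. Boundedness of `m` makes `m * log m` bounded, so
both integrals converge. The second is linear in `m`, which isolates the nonlinearity in the first.
-/
lemma klDiv_withDensity [IsProbabilityMeasure ρ] [IsProbabilityMeasure τ] (hac : ρ ≪ τ)
    (hint : Integrable (llr ρ τ) ρ) {m : α → ℝ} (hm : Measurable m) (hm0 : ∀ x, 0 ≤ m x)
    {C : ℝ} (hC : ∀ x, m x ≤ C) (h1 : ∫ x, m x ∂ρ = 1) :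
    klDiv (ρ.withDensity fun x => ENNReal.ofReal (m x)) τ ≠ ⊤ ∧
    (klDiv (ρ.withDensity fun x => ENNReal.ofReal (m x)) τ).toReal
      = ∫ x, m x * Real.log (m x) ∂ρ + ∫ x, m x * llr ρ τ x ∂ρ := by
  have hmb : ∀ x, |m x| ≤ C := fun x => by rw [abs_of_nonneg (hm0 x)]; exact hC x
  have hmint : Integrable m ρ :=
    Integrable.of_bound hm.aestronglyMeasurable C (ae_of_all _ hmb)
  have := isProbabilityMeasure_withDensity_ofReal hm0 hmint h1
  set σ := ρ.withDensity fun x => ENNReal.ofReal (m x) with hσ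
  have hσac : σ ≪ τ := (withDensity_absolutelyContinuous _ _).trans hac
  have i1 : Integrable (fun x => m x * Real.log (m x)) ρ := by
    obtain ⟨B, hB⟩ := (isCompact_Icc (a := (0 : ℝ)) (b := C)).exists_bound_of_continuousOn
      Real.continuous_mul_log.continuousOn
    exact Integrable.of_bound (hm.mul hm.log).aestronglyMeasurable B
      (ae_of_all _ fun x => hB _ ⟨hm0 x, hC x⟩)
  have i2 : Integrable (fun x => m x * llr ρ τ x) ρ :=
    hint.bdd_mul hm.aestronglyMeasurable (ae_of_all _ hmb)
  have hllr := llr_withDensity hac hm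
  have i3 : Integrable (llr σ τ) σ := by
    refine Integrable.congr ?_ (hllr.mono fun x hx => hx.symm)
    rw [hσ, integrable_withDensity_iff hm.ennreal_ofReal
      (ae_of_all _ fun _ => ENNReal.ofReal_lt_top)]
    refine (i1.add i2).congr (ae_of_all _ fun x => ?_)
    simp only [Pi.add_apply, ENNReal.toReal_ofReal (hm0 x)]
    ring
  refine ⟨klDiv_ne_top hσac i3, ?_⟩
  rw [toReal_klDiv_eq_integral_llr hσac, integral_congr_ae hllr,
    integral_withDensity_ofReal hm hm0, ← integral_add i1 i2]
  exact integral_congr_ae (ae_of_all _ fun x => mul_add _ _ _)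

lemma mul_log_le_sub_add_sq {x : ℝ} (hx : 0 ≤ x) : x * Real.log x ≤ (x - 1) + (x - 1) ^ 2 := by
  rcases hx.eq_or_lt with rfl | h
  · simp
  · nlinarith [Real.log_le_sub_one_of_pos h]

lemma sub_one_le_mul_log {x : ℝ} (hx : 0 ≤ x) : x - 1 ≤ x * Real.log x := by
  have := klFun_nonneg hx
  rw [klFun_apply] at this
  linarith

/-- The linear term m - 1 integrates to zero, so the entropy relative to `ρ` is of second order in m
- 1. This yields the first variation and also bounds the entropic loss in a transfer of mass. -/
lemma integral_mul_log_bounds [IsProbabilityMeasure ρ] {m : α → ℝ} (hm : Measurable m)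
    (hm0 : ∀ x, 0 ≤ m x) {C : ℝ} (hC : ∀ x, m x ≤ C) (h1 : ∫ x, m x ∂ρ = 1) :
    0 ≤ ∫ x, m x * Real.log (m x) ∂ρ ∧
      ∫ x, m x * Real.log (m x) ∂ρ ≤ ∫ x, (m x - 1) ^ 2 ∂ρ := by
  have hmb : ∀ x, |m x| ≤ C := fun x => by rw [abs_of_nonneg (hm0 x)]; exact hC x
  have hmint : Integrable m ρ :=
    Integrable.of_bound hm.aestronglyMeasurable C (ae_of_all _ hmb)
  have i1 : Integrable (fun x => m x * Real.log (m x)) ρ := by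
    obtain ⟨B, hB⟩ := (isCompact_Icc (a := (0 : ℝ)) (b := C)).exists_bound_of_continuousOn
      Real.continuous_mul_log.continuousOn
    exact Integrable.of_bound (hm.mul hm.log).aestronglyMeasurable B
      (ae_of_all _ fun x => hB _ ⟨hm0 x, hC x⟩)
  have i0 : Integrable (fun x => m x - 1) ρ := hmint.sub (integrable_const _)
  have i2 : Integrable (fun x => (m x - 1) ^ 2) ρ := by
    refine Integrable.of_bound ((hm.sub_const 1).pow_const 2).aestronglyMeasurable ((C + 1) ^ 2)
      (ae_of_all _ fun x => ?_)
    rw [Real.norm_eq_abs, abs_of_nonneg (sq_nonneg _)]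
    nlinarith [hm0 x, hC x]
  have e0 : ∫ x, (m x - 1) ∂ρ = 0 := by
    rw [integral_sub hmint (integrable_const _), h1]; simp
  constructor
  · rw [← e0]
    exact integral_mono i0 i1 fun x => sub_one_le_mul_log (hm0 x)
  · have : ∫ x, ((m x - 1) + (m x - 1) ^ 2) ∂ρ = ∫ x, (m x - 1) ^ 2 ∂ρ := by
      rw [integral_add i0 i2, e0, zero_add]
    rw [← this]
    exact integral_mono i1 (i0.add i2) fun x => mul_log_le_sub_add_sq (hm0 x)

end KullbackLeibler

/-! ### First variation of the divergence and its uniqueness -/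

section FirstVariation

variable {ρ τ : Measure ℝ}

lemma exists_real_density [IsProbabilityMeasure ρ] {g : ℝ → ℝ≥0∞} (hg : Measurable g)
    (hb : ∃ C : ℝ≥0∞, C ≠ ⊤ ∧ ∀ x, g x ≤ C) (h1 : ∫⁻ x, g x ∂ρ = 1) :
    ∃ f : ℝ → ℝ, Measurable f ∧ (∀ x, 0 ≤ f x) ∧ (∃ C : ℝ, ∀ x, f x ≤ C) ∧
      ∫ x, f x ∂ρ = 1 ∧ g = fun x => ENNReal.ofReal (f x) := by
  obtain ⟨C, hC, hle⟩ := hb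
  refine ⟨fun x => (g x).toReal, hg.ennreal_toReal, fun x => ENNReal.toReal_nonneg,
    ⟨C.toReal, fun x => ENNReal.toReal_mono hC (hle x)⟩, ?_, ?_⟩
  · rw [integral_toReal hg.aemeasurable (ae_of_all _ fun x => (hle x).trans_lt hC.lt_top), h1]
    simp
  · funext x
    exact (ENNReal.ofReal_toReal ((hle x).trans_lt hC.lt_top).ne).symm

lemma mix_withDensity {f : ℝ → ℝ} (hf : Measurable f) (hf0 : ∀ x, 0 ≤ f x)
    {ε : ℝ} (hε : ε ∈ Icc (0 : ℝ) 1) :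
    mix ρ (ρ.withDensity fun x => ENNReal.ofReal (f x)) ε
      = ρ.withDensity fun x => ENNReal.ofReal (1 + ε * (f x - 1)) := by
  have : (fun x => ENNReal.ofReal (1 + ε * (f x - 1)))
      = (fun _ => ENNReal.ofReal (1 - ε)) + ENNReal.ofReal ε • fun x => ENNReal.ofReal (f x) := by
    funext x
    simp only [Pi.add_apply, Pi.smul_apply, smul_eq_mul]
    rw [← ENNReal.ofReal_mul hε.1, ← ENNReal.ofReal_add (by linarith [hε.2])
      (mul_nonneg hε.1 (hf0 x))]
    congr 1; ring
  rw [this, withDensity_add_left measurable_const, withDensity_const,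
    withDensity_smul _ hf.ennreal_ofReal, mix]

lemma hasDerivWithinAt_zero_of_sq_bound {f : ℝ → ℝ} {K : ℝ}
    (hf : ∀ ε ∈ Icc (0 : ℝ) 1, |f ε| ≤ K * ε ^ 2) : HasDerivWithinAt f 0 (Ici 0) 0 := by
  have h0 : f 0 = 0 := by simpa using hf 0 (by simp)
  rw [hasDerivWithinAt_iff_isLittleO]
  simp only [h0, sub_zero, smul_zero]
  have hbig : f =O[𝓝[Ici 0] 0] fun ε : ℝ => ε ^ 2 := by
    refine Asymptotics.IsBigO.of_bound K ?_
    filter_upwards [Icc_mem_nhdsGE (zero_lt_one' ℝ)] with ε hε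
    simpa [abs_of_nonneg (sq_nonneg ε)] using hf ε hε
  refine hbig.trans_isLittleO ?_
  refine Asymptotics.IsLittleO.mono ?_ nhdsWithin_le_nhds
  exact Asymptotics.isLittleO_pow_id one_lt_two

/-- The mixture has density 1 + ε(f - 1) relative to `ρ`. Its entropy is nonnegative and O(ε²),
hence has derivative zero at 0⁺; the remaining term is affine in ε and supplies the derivative. -/
lemma isFirstVariation_klDiv [IsProbabilityMeasure ρ] [IsProbabilityMeasure τ] (hac : ρ ≪ τ)
    (hint : Integrable (llr ρ τ) ρ) {φ : ℝ → ℝ} (hφ : φ =ᵐ[ρ] llr ρ τ) :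
    IsFirstVariation (fun μ => klDiv μ τ) ρ φ := by
  refine ⟨hint.congr hφ.symm, fun g hg hb h1 => ?_⟩
  obtain ⟨f, hf, hf0, ⟨C, hC⟩, hf1, rfl⟩ := exists_real_density hg hb h1
  have hfint : Integrable f ρ := Integrable.of_bound hf.aestronglyMeasurable C
    (ae_of_all _ fun x => by rw [Real.norm_eq_abs, abs_of_nonneg (hf0 x)]; exact hC x)
  have hm : ∀ ε : ℝ, Measurable fun x => 1 + ε * (f x - 1) := fun ε => by fun_prop
  have hm0 : ∀ ε ∈ Icc (0 : ℝ) 1, ∀ x, 0 ≤ 1 + ε * (f x - 1) := fun ε hε x => by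
    nlinarith [hf0 x, hε.1, hε.2, mul_nonneg hε.1 (hf0 x)]
  have hmC : ∀ ε ∈ Icc (0 : ℝ) 1, ∀ x, 1 + ε * (f x - 1) ≤ 1 + |C| := fun ε hε x => by
    have := hC x
    have := le_abs_self C
    have := mul_le_mul_of_nonneg_left (this : C ≤ |C|) hε.1
    have := mul_le_mul_of_nonneg_left (hC x) hε.1
    have := mul_le_mul_of_nonneg_right hε.2 (abs_nonneg C)
    nlinarith [hε.1]
  have hm1 : ∀ ε : ℝ, ∫ x, (1 + ε * (f x - 1)) ∂ρ = 1 := fun ε => by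
    have i : Integrable (fun x => ε * (f x - 1)) ρ := (hfint.sub (integrable_const _)).const_mul ε
    rw [integral_add (integrable_const _) i, integral_const_mul, integral_sub hfint (integrable_const _), hf1]
    simp
  have key := fun ε (hε : ε ∈ Icc (0 : ℝ) 1) =>
    klDiv_withDensity hac hint (hm ε) (hm0 ε hε) (hmC ε hε) (hm1 ε)
  have bnd := fun ε (hε : ε ∈ Icc (0 : ℝ) 1) =>
    integral_mul_log_bounds (hm ε) (hm0 ε hε) (hmC ε hε) (hm1 ε)
  refine ⟨fun ε hε => by rw [mix_withDensity hf hf0 hε]; exact (key ε hε).1, ?_⟩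
  have il : Integrable (fun x => f x * llr ρ τ x) ρ :=
    hint.bdd_mul (c := C) hf.aestronglyMeasurable
      (ae_of_all _ fun x => by rw [Real.norm_eq_abs, abs_of_nonneg (hf0 x)]; exact hC x)
  have hlin : ∀ ε : ℝ, ∫ x, (1 + ε * (f x - 1)) * llr ρ τ x ∂ρ
      = ∫ x, llr ρ τ x ∂ρ + ε * (∫ x, f x * llr ρ τ x ∂ρ - ∫ x, llr ρ τ x ∂ρ) := fun ε => by
    have i : Integrable (fun x => ε * (f x * llr ρ τ x - llr ρ τ x)) ρ :=
      (il.sub hint).const_mul ε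
    rw [← integral_sub il hint, ← integral_const_mul, ← integral_add hint i]
    refine integral_congr_ae (ae_of_all _ fun x => ?_)
    ring
  have hD1 : HasDerivWithinAt (fun ε : ℝ => ∫ x, llr ρ τ x ∂ρ
      + ε * (∫ x, f x * llr ρ τ x ∂ρ - ∫ x, llr ρ τ x ∂ρ))
      (∫ x, f x * llr ρ τ x ∂ρ - ∫ x, llr ρ τ x ∂ρ) (Ici 0) 0 := by
    simpa using (((hasDerivAt_id (0 : ℝ)).mul_const
      (∫ x, f x * llr ρ τ x ∂ρ - ∫ x, llr ρ τ x ∂ρ)).const_add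
        (∫ x, llr ρ τ x ∂ρ)).hasDerivWithinAt (s := Ici 0)
  have hD2 : HasDerivWithinAt (fun ε : ℝ => ∫ x, (1 + ε * (f x - 1)) *
      Real.log (1 + ε * (f x - 1)) ∂ρ) 0 (Ici 0) 0 := by
    refine hasDerivWithinAt_zero_of_sq_bound (K := ∫ x, (f x - 1) ^ 2 ∂ρ) fun ε hε => ?_
    rw [abs_of_nonneg (bnd ε hε).1]
    refine (bnd ε hε).2.trans (le_of_eq ?_)
    rw [← integral_mul_const]
    refine integral_congr_ae (ae_of_all _ fun x => ?_)
    ring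
  have hD := hD2.add hD1
  rw [zero_add] at hD
  have hφ' : φ =ᵐ[ρ.withDensity fun x => ENNReal.ofReal (f x)] llr ρ τ :=
    (withDensity_absolutelyContinuous _ _).ae_le hφ
  rw [integral_congr_ae hφ', integral_congr_ae hφ, integral_withDensity_ofReal hf hf0]
  have heq : ∀ ε ∈ Icc (0 : ℝ) 1,
      (klDiv (mix ρ (ρ.withDensity fun x => ENNReal.ofReal (f x)) ε) τ).toReal
        = ∫ x, (1 + ε * (f x - 1)) * Real.log (1 + ε * (f x - 1)) ∂ρ +
          (∫ x, llr ρ τ x ∂ρ + ε * (∫ x, f x * llr ρ τ x ∂ρ - ∫ x, llr ρ τ x ∂ρ)) :=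
    fun ε hε => by rw [mix_withDensity hf hf0 hε, (key ε hε).2, hlin]
  refine hD.congr_of_eventuallyEq ?_ (heq 0 (by simp))
  filter_upwards [Icc_mem_nhdsGE (zero_lt_one' ℝ)] with ε hε using heq ε hε

/-- Testing with `ρ` conditioned on a set A shows that φ - ψ has the same average over every A of
positive measure as over the whole line. -/
lemma IsFirstVariation.ae_eq_add_const {F : Measure ℝ → ℝ≥0∞} [IsProbabilityMeasure ρ]
    {φ ψ : ℝ → ℝ} (hφ : IsFirstVariation F ρ φ) (hψ : IsFirstVariation F ρ ψ) :
    ∃ c : ℝ, ∀ᵐ x ∂ρ, φ x = ψ x + c := by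
  refine ⟨∫ x, φ x ∂ρ - ∫ x, ψ x ∂ρ, ?_⟩
  have hint : Integrable (fun x => φ x - ψ x) ρ := hφ.1.sub hψ.1
  suffices h : (fun x => φ x - ψ x) =ᵐ[ρ] fun _ => ∫ x, φ x ∂ρ - ∫ x, ψ x ∂ρ by
    filter_upwards [h] with x hx; linarith
  refine hint.ae_eq_of_forall_setIntegral_eq _ _ (integrable_const _) fun A hA _ => ?_
  by_cases hA0 : ρ A = 0
  · rw [Measure.restrict_eq_zero.2 hA0]; simp
  have hr : 0 < ρ.real A := 
    ENNReal.toReal_pos hA0 (measure_ne_top _ _)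
  set f : ℝ → ℝ := A.indicator fun _ => (ρ.real A)⁻¹ with hf
  have hfm : Measurable f := measurable_const.indicator hA
  have hf0 : ∀ x, 0 ≤ f x := fun x => indicator_nonneg (fun _ _ => by positivity) x
  have hfC : ∀ x, f x ≤ (ρ.real A)⁻¹ := fun x => indicator_le_self' (fun _ _ => by positivity) x
  have hg : ∫⁻ x, ENNReal.ofReal (f x) ∂ρ = 1 := by
    rw [← ofReal_integral_eq_lintegral_ofReal _ (ae_of_all _ hf0), hf, integral_indicator hA]
    · simp [hr.ne']
    · exact (integrable_const _).indicator hA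
  have hb : ∃ C : ℝ≥0∞, C ≠ ⊤ ∧ ∀ x, ENNReal.ofReal (f x) ≤ C :=
    ⟨_, ENNReal.ofReal_ne_top, fun x => ENNReal.ofReal_le_ofReal (hfC x)⟩
  have e := (uniqueDiffWithinAt_Ici (0 : ℝ)).eq_deriv _
    (hφ.2 _ hfm.ennreal_ofReal hb hg).2 (hψ.2 _ hfm.ennreal_ofReal hb hg).2
  have hint' : ∀ u : ℝ → ℝ, ∫ x, u x ∂(ρ.withDensity fun x => ENNReal.ofReal (f x))
      = (ρ.real A)⁻¹ * ∫ x in A, u x ∂ρ := fun u => by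
    rw [integral_withDensity_ofReal hfm hf0, ← integral_const_mul, ← integral_indicator hA]
    refine integral_congr_ae (ae_of_all _ fun x => ?_)
    by_cases hx : x ∈ A <;> simp [hf, hx]
  rw [hint', hint'] at e
  rw [integral_sub hφ.1.integrableOn hψ.1.integrableOn, setIntegral_const, smul_eq_mul]
  field_simp at e
  linarith

end FirstVariation

/-! ### Existence and monotonicity of optimal plans -/

section OptimalPlans

variable {μ ν : Measure ℝ} {γ : Measure (ℝ × ℝ)}

lemma isProbabilityMeasure_of_mem_plans [IsProbabilityMeasure μ] (h : γ ∈ plans μ ν) :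
    IsProbabilityMeasure γ := by
  constructor
  have := measure_univ (μ := μ)
  rwa [← h.1, Measure.map_apply measurable_fst MeasurableSet.univ, preimage_univ] at this

lemma prod_mem_plans [IsProbabilityMeasure μ] [IsProbabilityMeasure ν] :
    μ.prod ν ∈ plans μ ν := by
  constructor <;> simp [Measure.map_fst_prod, Measure.map_snd_prod]

lemma measurable_edist_sq : Measurable fun z : ℝ × ℝ => edist z.1 z.2 ^ 2 := by fun_prop

lemma edist_sq_eq_ofReal (a b : ℝ) : edist a b ^ 2 = ENNReal.ofReal ((a - b) ^ 2) := by
  rw [edist_dist, Real.dist_eq, ← ENNReal.ofReal_pow (abs_nonneg _), sq_abs]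

lemma ofReal_sq_eq_enorm (x : ℝ) : ENNReal.ofReal (x ^ 2) = ‖x‖ₑ ^ 2 := by
  rw [Real.enorm_eq_ofReal_abs, ← ENNReal.ofReal_pow (abs_nonneg _), sq_abs]

lemma cost_lt_top (hμ : μ ∈ P2) (hν : ν ∈ P2) (h : γ ∈ plans μ ν) : cost γ < ⊤ := by
  have hle : ∀ z : ℝ × ℝ, edist z.1 z.2 ^ 2 ≤ 2 * ‖z.1‖ₑ ^ 2 + 2 * ‖z.2‖ₑ ^ 2 := fun z => by
    rw [edist_sq_eq_ofReal, ← ofReal_sq_eq_enorm, ← ofReal_sq_eq_enorm,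
      show (2 : ℝ≥0∞) = ENNReal.ofReal 2 by simp, ← ENNReal.ofReal_mul zero_le_two,
      ← ENNReal.ofReal_mul zero_le_two, ← ENNReal.ofReal_add (by positivity) (by positivity)]
    exact ENNReal.ofReal_le_ofReal (by nlinarith [sq_nonneg (z.1 + z.2)])
  refine (lintegral_mono hle).trans_lt ?_
  rw [lintegral_add_left (by fun_prop), lintegral_const_mul _ (by fun_prop),
    lintegral_const_mul _ (by fun_prop)]
  have h1 : ∫⁻ z, ‖z.1‖ₑ ^ 2 ∂γ < ⊤ := by
    have := hμ.2
    rwa [← h.1, lintegral_map (by fun_prop) measurable_fst] at this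
  have h2 : ∫⁻ z, ‖z.2‖ₑ ^ 2 ∂γ < ⊤ := by
    have := hν.2
    rwa [← h.2, lintegral_map (by fun_prop) measurable_snd] at this
  exact ENNReal.add_lt_top.2 ⟨ENNReal.mul_lt_top (by simp) h1, ENNReal.mul_lt_top (by simp) h2⟩

/-- The cost is the supremum of the integrals of the truncations min(|x-y|², n), each weakly
continuous in the plan. -/
lemma lowerSemicontinuous_cost :
    LowerSemicontinuous fun γ : ProbabilityMeasure (ℝ × ℝ) => cost (γ : Measure (ℝ × ℝ)) := by
  let g : ℕ → BoundedContinuousFunction (ℝ × ℝ) NNReal := fun n =>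
    BoundedContinuousFunction.mkOfBound
      ⟨fun z => min (nndist z.1 z.2 ^ 2) n, by fun_prop⟩ n (fun x y => by
        rw [NNReal.dist_eq, abs_le]
        have hx : ((min (nndist x.1 x.2 ^ 2) (n : NNReal) : NNReal) : ℝ) ≤ n := by
          exact_mod_cast min_le_right (nndist x.1 x.2 ^ (2 : ℕ)) (n : NNReal)
        have hy : ((min (nndist y.1 y.2 ^ 2) (n : NNReal) : NNReal) : ℝ) ≤ n := by
          exact_mod_cast min_le_right (nndist y.1 y.2 ^ (2 : ℕ)) (n : NNReal)
        have hx0 := (min (nndist x.1 x.2 ^ 2) (n : NNReal)).coe_nonneg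
        have hy0 := (min (nndist y.1 y.2 ^ 2) (n : NNReal)).coe_nonneg
        simp only [ContinuousMap.coe_mk]
        constructor <;> linarith)
  have hg : ∀ n z, g n z = min (nndist z.1 z.2 ^ 2) (n : NNReal) := fun _ _ => rfl
  have hsup : ∀ z : ℝ × ℝ, edist z.1 z.2 ^ 2 = ⨆ n, (g n z : ℝ≥0∞) := fun z => by
    apply le_antisymm
    · obtain ⟨n, hn⟩ := exists_nat_ge (nndist z.1 z.2 ^ 2)
      refine le_iSup_of_le n ?_
      rw [hg, min_eq_left hn, edist_nndist]
      simp
    · refine iSup_le fun n => ?_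
      rw [hg, edist_nndist, ← ENNReal.coe_pow]
      exact ENNReal.coe_le_coe.2 (min_le_left _ _)
  have hcost : (fun γ : ProbabilityMeasure (ℝ × ℝ) => cost (γ : Measure (ℝ × ℝ)))
      = fun γ => ⨆ n, (γ.toFiniteMeasure.testAgainstNN (g n) : ℝ≥0∞) := by
    funext γ
    simp only [FiniteMeasure.testAgainstNN_coe_eq, cost]
    rw [lintegral_congr hsup, lintegral_iSup]
    · rfl
    · intro n
      exact (g n).continuous.measurable.coe_nnreal_ennreal
    · intro n m hnm z
      simp only [hg]
      exact ENNReal.coe_le_coe.2 (min_le_min_left _ (by exact_mod_cast hnm))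
  rw [hcost]
  exact lowerSemicontinuous_iSup fun n => Continuous.lowerSemicontinuous
    (ENNReal.continuous_coe.comp (ProbabilityMeasure.continuous_testAgainstNN_eval (g n)))

/-- Direct method: fixed marginals make the set of plans tight and closed, hence compact by
Prokhorov, and the cost is lower semicontinuous. -/
lemma exists_isOptimalPlan [IsProbabilityMeasure μ] [IsProbabilityMeasure ν] :
    ∃ γ, IsOptimalPlan μ ν γ := by
  let S : Set (ProbabilityMeasure (ℝ × ℝ)) := {γ | (γ : Measure (ℝ × ℝ)) ∈ plans μ ν}
  let μ' : ProbabilityMeasure ℝ := ⟨μ, inferInstance⟩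
  let ν' : ProbabilityMeasure ℝ := ⟨ν, inferInstance⟩
  have hS : S = (fun γ => ProbabilityMeasure.map γ measurable_fst.aemeasurable) ⁻¹' {μ'} ∩
      (fun γ => ProbabilityMeasure.map γ measurable_snd.aemeasurable) ⁻¹' {ν'} := by
    ext γ
    simp only [S, plans, mem_ofPred_eq, mem_inter_iff, mem_preimage, mem_singleton_iff]
    exact ⟨fun h => ⟨Subtype.ext h.1, Subtype.ext h.2⟩,
      fun h => ⟨congrArg Subtype.val h.1, congrArg Subtype.val h.2⟩⟩
  have hclosed : IsClosed S := by
    rw [hS]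
    exact (isClosed_singleton.preimage (ProbabilityMeasure.continuous_map continuous_fst)).inter
      (isClosed_singleton.preimage (ProbabilityMeasure.continuous_map continuous_snd))
  have htight : IsTightMeasureSet {((γ : ProbabilityMeasure (ℝ × ℝ)) : Measure (ℝ × ℝ)) | γ ∈ S} := by
    refine IsTightMeasureSet.prodMk ?_ ?_
    · refine (isTightMeasureSet_singleton (μ := μ)).subset ?_
      rintro _ ⟨_, ⟨γ, hγ, rfl⟩, rfl⟩
      exact hγ.1
    · refine (isTightMeasureSet_singleton (μ := ν)).subset ?_
      rintro _ ⟨_, ⟨γ, hγ, rfl⟩, rfl⟩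
      exact hγ.2
  have hcpt : IsCompact S := by
    have := isCompact_closure_of_isTightMeasureSet htight
    rwa [hclosed.closure_eq] at this
  have hne : S.Nonempty := ⟨⟨μ.prod ν, inferInstance⟩, prod_mem_plans⟩
  obtain ⟨γ, hγ, hmin⟩ := (lowerSemicontinuous_cost.lowerSemicontinuousOn S).exists_isMinOn hne hcpt
  refine ⟨γ, hγ, fun γ' hγ' => ?_⟩
  have := isProbabilityMeasure_of_mem_plans hγ'
  exact hmin (a := (⟨γ', this⟩ : ProbabilityMeasure (ℝ × ℝ))) hγ'

/-- Pairs of points of the plane at which a coupling is strictly decreasing. -/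
def crossing : Set ((ℝ × ℝ) × (ℝ × ℝ)) :=
  {w | (w.1.1 - w.2.1) * (w.1.2 - w.2.2) < 0}

lemma isOpen_crossing : IsOpen crossing :=
  isOpen_lt (by fun_prop) continuous_const

lemma swap_preimage_crossing : Prod.swap ⁻¹' crossing = crossing := by
  ext w
  simp only [crossing, mem_preimage, mem_ofPred_eq, Prod.fst_swap, Prod.snd_swap]
  rw [show (w.2.1 - w.1.1) * (w.2.2 - w.1.2) = (w.1.1 - w.2.1) * (w.1.2 - w.2.2) by ring]

lemma setLIntegral_crossing_swap [SFinite γ] (f : (ℝ × ℝ) × (ℝ × ℝ) → ℝ≥0∞) (hf : Measurable f) :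
    ∫⁻ w in crossing, f w.swap ∂(γ.prod γ) = ∫⁻ w in crossing, f w ∂(γ.prod γ) := by
  conv_rhs => rw [← Measure.prod_swap (μ := γ) (ν := γ)]
  rw [setLIntegral_map isOpen_crossing.measurableSet hf measurable_swap, swap_preimage_crossing]

open Classical in
/-- Exchange the second coordinates of a pair of points at a crossing. -/
noncomputable def uncross (w : (ℝ × ℝ) × (ℝ × ℝ)) : ℝ × ℝ :=
  (w.1.1, if w ∈ crossing then w.2.2 else w.1.2)

lemma measurable_uncross : Measurable uncross := by
  refine Measurable.prodMk (by fun_prop) ?_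
  exact Measurable.ite isOpen_crossing.measurableSet (by fun_prop) (by fun_prop)

lemma lintegral_uncross [SFinite γ] (f : ℝ × ℝ → ℝ≥0∞) :
    ∫⁻ w, f (uncross w) ∂(γ.prod γ)
      = ∫⁻ w in crossing, f (w.1.1, w.2.2) ∂(γ.prod γ)
        + ∫⁻ w in crossingᶜ, f w.1 ∂(γ.prod γ) := by
  rw [← lintegral_add_compl _ isOpen_crossing.measurableSet]
  congr 1
  · refine setLIntegral_congr_fun isOpen_crossing.measurableSet fun w hw => ?_
    simp [uncross, hw]
  · refine setLIntegral_congr_fun isOpen_crossing.measurableSet.compl fun w hw => ?_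
    have : w ∉ crossing := hw
    simp [uncross, this]

lemma lintegral_fst_split [IsProbabilityMeasure γ] {f : ℝ × ℝ → ℝ≥0∞} (hf : Measurable f) :
    ∫⁻ z, f z ∂γ = ∫⁻ w in crossing, f w.1 ∂(γ.prod γ)
        + ∫⁻ w in crossingᶜ, f w.1 ∂(γ.prod γ) := by
  rw [lintegral_add_compl _ isOpen_crossing.measurableSet]
  have : γ = (γ.prod γ).map Prod.fst := by simp [Measure.map_fst_prod]
  conv_lhs => rw [this]
  rw [lintegral_map hf measurable_fst]

/-- Draw two independent pairs from `γ` and keep the first, replacing its target by that of the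
second at a crossing. The second marginal survives because `crossing` is invariant under swapping
the two pairs. -/
lemma uncross_mem_plans [IsProbabilityMeasure γ] (h : γ ∈ plans μ ν) :
    (γ.prod γ).map uncross ∈ plans μ ν := by
  constructor
  · rw [Measure.map_map measurable_fst measurable_uncross, ← h.1]
    have : Prod.fst ∘ uncross = Prod.fst ∘ (Prod.fst : (ℝ × ℝ) × (ℝ × ℝ) → ℝ × ℝ) := rfl
    rw [this, ← Measure.map_map measurable_fst measurable_fst, Measure.map_fst_prod]
    simp
  · refine Measure.ext_of_lintegral _ fun f hf => ?_
    rw [lintegral_map hf measurable_snd,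
      lintegral_map (f := fun z : ℝ × ℝ => f z.2) (hf.comp measurable_snd) measurable_uncross,
      lintegral_uncross (fun z => f z.2), ← h.2, lintegral_map hf measurable_snd,
      lintegral_fst_split (f := fun z => f z.2) (hf.comp measurable_snd)]
    congr 1
    exact setLIntegral_crossing_swap (fun w => f w.1.2) (by fun_prop)

/-- If crossings had positive mass, uncrossing would give a strictly cheaper plan. The pointwise
gain concerns the sum over both pairs, so it is compared with the cost of one pair by the swap
symmetry. -/
lemma IsOptimalPlan.prod_crossing_eq_zero [IsProbabilityMeasure γ] (h : IsOptimalPlan μ ν γ)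
    (hfin : cost γ < ⊤) : γ.prod γ crossing = 0 := by
  by_contra hpos
  have hle := h.2 _ (uncross_mem_plans h.1)
  rw [cost, cost, lintegral_map measurable_edist_sq measurable_uncross,
    lintegral_uncross (fun z => edist z.1 z.2 ^ 2), lintegral_fst_split measurable_edist_sq] at hle
  have hsplit := lintegral_fst_split (γ := γ) measurable_edist_sq
  change cost γ = _ at hsplit
  rw [hsplit] at hfin
  have hfin1 := (ENNReal.add_lt_top.1 hfin).1
  have hfin2 := (ENNReal.add_lt_top.1 hfin).2
  -- Off the crossings nothing changes; that common part is finite and cancels.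
  have hle' : ∫⁻ w in crossing, edist w.1.1 w.1.2 ^ 2 ∂(γ.prod γ)
      ≤ ∫⁻ w in crossing, edist w.1.1 w.2.2 ^ 2 ∂(γ.prod γ) := (ENNReal.add_le_add_iff_right hfin2.ne).1 hle
  have e1 := setLIntegral_crossing_swap (γ := γ) (fun w => edist w.1.1 w.2.2 ^ 2) (by fun_prop)
  have e2 := setLIntegral_crossing_swap (γ := γ) (fun w => edist w.1.1 w.1.2 ^ 2) (by fun_prop)
  -- The left side minus the right side is 2(x₁ - x₂)(y₁ - y₂), negative at a crossing.
  have hpt : ∀ w ∈ crossing, edist w.1.1 w.2.2 ^ 2 + edist w.2.1 w.1.2 ^ 2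
      < edist w.1.1 w.1.2 ^ 2 + edist w.2.1 w.2.2 ^ 2 := fun w hw => by
    simp only [edist_sq_eq_ofReal]
    rw [← ENNReal.ofReal_add (sq_nonneg _) (sq_nonneg _),
      ← ENNReal.ofReal_add (sq_nonneg _) (sq_nonneg _)]
    have hw' : (w.1.1 - w.2.1) * (w.1.2 - w.2.2) < 0 := hw
    refine (ENNReal.ofReal_lt_ofReal_iff_of_nonneg (by positivity)).2 ?_
    nlinarith
  have hlt : ∫⁻ w in crossing, (edist w.1.1 w.2.2 ^ 2 + edist w.2.1 w.1.2 ^ 2) ∂(γ.prod γ)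
      < ∫⁻ w in crossing, (edist w.1.1 w.1.2 ^ 2 + edist w.2.1 w.2.2 ^ 2) ∂(γ.prod γ) := by
    refine setLIntegral_strict_mono isOpen_crossing.measurableSet hpos (by fun_prop) ?_
      (ae_of_all _ hpt)
    refine ((setLIntegral_mono (by fun_prop) fun w hw => (hpt w hw).le).trans_lt ?_).ne
    rw [lintegral_add_left (by fun_prop)]
    exact ENNReal.add_lt_top.2 ⟨hfin1, e2.trans_lt hfin1⟩
  rw [lintegral_add_left (by fun_prop), lintegral_add_left (by fun_prop)] at hlt
  have e1' : ∫⁻ w in crossing, edist w.2.1 w.1.2 ^ 2 ∂(γ.prod γ)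
      = ∫⁻ w in crossing, edist w.1.1 w.2.2 ^ 2 ∂(γ.prod γ) := e1
  have e2' : ∫⁻ w in crossing, edist w.2.1 w.2.2 ^ 2 ∂(γ.prod γ)
      = ∫⁻ w in crossing, edist w.1.1 w.1.2 ^ 2 ∂(γ.prod γ) := e2
  rw [e1', e2'] at hlt
  exact absurd (add_le_add hle' hle') (not_le.2 hlt)

/-- `crossing` is open, so a crossing pair of support points would have a product neighbourhood of
positive mass inside a null set. -/
lemma IsOptimalPlan.monotone_support [IsProbabilityMeasure γ] (h : IsOptimalPlan μ ν γ)
    (hfin : cost γ < ⊤) {z w : ℝ × ℝ} (hz : z ∈ γ.support) (hw : w ∈ γ.support) :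
    0 ≤ (z.1 - w.1) * (z.2 - w.2) := by
  by_contra! hneg
  have hmem : crossing ∈ 𝓝 (z, w) := isOpen_crossing.mem_nhds hneg
  obtain ⟨U, hU, V, hV, hUV⟩ := mem_nhds_prod_iff.1 hmem
  have := Measure.mem_support_iff_forall z |>.1 hz U hU
  have h2 := Measure.mem_support_iff_forall w |>.1 hw V hV
  have h0 := measure_mono_null hUV (h.prod_crossing_eq_zero hfin)
  rw [Measure.prod_prod] at h0
  exact mul_ne_zero this.ne' h2.ne' h0

lemma W2_sq_eq_iInf : W2 μ ν ^ 2 = ⨅ γ ∈ plans μ ν, cost γ := by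
  rw [W2, ← ENNReal.rpow_natCast, ← ENNReal.rpow_mul]
  norm_num

lemma IsOptimalPlan.W2_sq (h : IsOptimalPlan μ ν γ) : W2 μ ν ^ 2 = cost γ := by
  rw [W2_sq_eq_iInf]
  exact le_antisymm (iInf₂_le _ h.1) (le_iInf₂ h.2)

lemma W2_sq_le_cost (h : γ ∈ plans μ ν) : W2 μ ν ^ 2 ≤ cost γ := by
  rw [W2_sq_eq_iInf]
  exact iInf₂_le _ h

end OptimalPlans

/-! ### Monotone parametrization and one-sided change of variables -/

section Interpolation

/-- A totally ordered subset of the plane is parametrized over the line by the increasing functions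
inverting `z ↦ (1 - t) z₁ + t z₂`. -/
lemma exists_monotone_parametrization {Γ : Set (ℝ × ℝ)} (hne : Γ.Nonempty)
    (hΓ : ∀ z ∈ Γ, ∀ w ∈ Γ, 0 ≤ (z.1 - w.1) * (z.2 - w.2)) {t : ℝ} (ht0 : 0 < t) (ht1 : t < 1) :
    ∃ X Y : ℝ → ℝ, Monotone X ∧ Monotone Y ∧ (∀ u, (1 - t) * X u + t * Y u = u) ∧
      ∀ z ∈ Γ, X ((1 - t) * z.1 + t * z.2) = z.1 ∧ Y ((1 - t) * z.1 + t * z.2) = z.2 := by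
  have hs : 0 < 1 - t := by linarith
  let Z : ℝ × ℝ → ℝ := fun z => (1 - t) * z.1 + t * z.2
  -- A McShane extension with Lipschitz constant 1/(1-t). The positive part replaces the absolute
  -- value so that the infimum is also increasing.
  let T : Γ → ℝ → ℝ := fun z u => z.1.1 + max (u - Z z) 0 / (1 - t)
  let X : ℝ → ℝ := fun u => ⨅ z : Γ, T z u
  -- This bounds the infimum below at every u, and at u = Z w it shows that the infimum is not less
  -- than w.1.
  have hlow : ∀ w ∈ Γ, ∀ z : Γ, ∀ u, w.1 - |u - Z w| / (1 - t) ≤ T z u := by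
    rintro w hw ⟨z, hz⟩ u
    have hzw := hΓ z hz w hw
    simp only [T]
    rw [sub_le_iff_le_add, add_assoc, ← add_div]
    rcases le_or_gt w.1 z.1 with h | h
    · have : 0 ≤ (max (u - Z z) 0 + |u - Z w|) / (1 - t) := by positivity
      linarith
    · have h2 : z.2 ≤ w.2 := by nlinarith
      have h3 : (1 - t) * (w.1 - z.1) ≤ Z w - Z z := by
        simp only [Z]; nlinarith
      have h4 : (w.1 - z.1) ≤ (max (u - Z z) 0 + |u - Z w|) / (1 - t) := by
        rw [le_div_iff₀ hs]
        have := le_max_left (u - Z z) 0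
        have := neg_abs_le (u - Z w)
        linarith
      linarith
  obtain ⟨w₀, hw₀⟩ := hne
  have : Nonempty Γ := ⟨⟨w₀, hw₀⟩⟩
  have hbdd : ∀ u, BddBelow (range fun z : Γ => T z u) := fun u =>
    ⟨_, by rintro _ ⟨z, rfl⟩; exact hlow w₀ hw₀ z u⟩
  have hXmono : Monotone X := fun u v huv => ciInf_mono (hbdd u) fun z => by
    simp only [T]; gcongr
  have hXlip : ∀ u v, u ≤ v → X v ≤ X u + (v - u) / (1 - t) := fun u v huv => by
    rw [← sub_le_iff_le_add]
    refine le_ciInf fun z => ?_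
    rw [sub_le_iff_le_add]
    refine (ciInf_le (hbdd v) z).trans ?_
    simp only [T]
    rw [add_assoc, ← add_div]
    gcongr
    refine max_le ?_ ?_
    · linarith [le_max_left (u - Z z) 0]
    · linarith [le_max_right (u - Z z) 0]
  have hXeq : ∀ z ∈ Γ, X (Z z) = z.1 := fun z hz => by
    apply le_antisymm
    · refine (ciInf_le (hbdd _) ⟨z, hz⟩).trans ?_
      simp [T]
    · refine le_ciInf fun w => ?_
      simpa using hlow z hz w (Z z)
  -- Y is forced by the combination identity; it increases because X grows at rate at most 1/(1-t).
  refine ⟨X, fun u => (u - (1 - t) * X u) / t, hXmono, fun u v huv => ?_, fun u => ?_,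
    fun z hz => ⟨hXeq z hz, ?_⟩⟩
  · have h := hXlip u v huv
    have h' : (1 - t) * X v ≤ (1 - t) * X u + (v - u) := by
      have := mul_le_mul_of_nonneg_left h hs.le
      rwa [mul_add, mul_div_cancel₀ _ hs.ne'] at this
    simp only
    gcongr ?_ / t
    linarith
  · field_simp
    ring
  · have := hXeq z hz
    simp only [Z] at this
    simp only [this]
    field_simp
    ring

/-- The increments of sX and tY are nonnegative and add up to that of u, so neither exceeds it. -/
lemma lipschitzWith_of_monotone_of_combination {X Y : ℝ → ℝ} (hX : Monotone X) (hY : Monotone Y)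
    {s t : ℝ} (hs : 0 < s) (ht : 0 ≤ t) (h : ∀ u, s * X u + t * Y u = u) :
    LipschitzWith (Real.toNNReal s⁻¹) X := by
  refine LipschitzWith.of_le_add_mul _ fun u v => ?_
  rw [Real.coe_toNNReal _ (by positivity), Real.dist_eq]
  rcases le_total u v with huv | huv
  · have := hX huv
    have : 0 ≤ s⁻¹ * |u - v| := by positivity
    linarith
  · have h1 : s * (X u - X v) ≤ u - v := by
      have := mul_nonneg ht (sub_nonneg.2 (hY huv))
      linarith [h u, h v]
    rw [abs_of_nonneg (by linarith), ← sub_le_iff_le_add', inv_mul_eq_div, le_div_iff₀ hs]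
    linarith

lemma volume_image_le_of_differentiableOn {X : ℝ → ℝ} {s : Set ℝ} (hs : MeasurableSet s)
    (hX : ∀ x ∈ s, DifferentiableAt ℝ X x) :
    volume (X '' s) ≤ ∫⁻ x in s, ENNReal.ofReal |deriv X x| := by
  refine (addHaar_image_le_lintegral_abs_det_fderiv volume hs
    (fun x hx => (hX x hx).hasDerivAt.hasFDerivAt.hasFDerivWithinAt)).trans (le_of_eq ?_)
  simp

/-- Only the inequality half of the area formula is used, so X need not be injective. -/
lemma withDensity_image_le {X : ℝ → ℝ} (hXm : Measurable X) {p : ℝ → ℝ≥0∞} (hp : Measurable p)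
    {s : Set ℝ} (hs : MeasurableSet s) (hX : ∀ x ∈ s, DifferentiableAt ℝ X x) :
    volume.withDensity p (X '' s) ≤ ∫⁻ x in s, p (X x) * ENNReal.ofReal |deriv X x| := by
  have hd : Measurable fun x => ENNReal.ofReal |deriv X x| := by
    have := measurable_deriv X
    fun_prop
  have hle : volume.restrict (X '' s)
      ≤ ((volume.withDensity fun x => ENNReal.ofReal |deriv X x|).restrict s).map X := by
    refine Measure.le_iff.2 fun E hE => ?_
    rw [Measure.restrict_apply hE, Measure.map_apply hXm hE, Measure.restrict_apply (hXm hE),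
      withDensity_apply _ ((hXm hE).inter hs)]
    refine le_trans (measure_mono ?_) (volume_image_le_of_differentiableOn ((hXm hE).inter hs)
      fun x hx => hX x hx.2)
    rintro _ ⟨hy, x, hx, rfl⟩
    exact ⟨x, ⟨hy, hx⟩, rfl⟩
  rw [withDensity_apply' _ _]
  refine (lintegral_mono' hle le_rfl).trans (le_of_eq ?_)
  rw [lintegral_map hp hXm, restrict_withDensity hs,
    lintegral_withDensity_eq_lintegral_mul _ hd (g := fun x => p (X x)) (hp.comp hXm)]
  refine lintegral_congr fun x => ?_
  simp [mul_comm]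

lemma LipschitzWith.volume_image_eq_zero {X : ℝ → ℝ} {K : NNReal} (hX : LipschitzWith K X)
    {N : Set ℝ} (hN : volume N = 0) : volume (X '' N) = 0 := by
  have := hX.hausdorffMeasure_image_le zero_le_one N
  rw [hausdorffMeasure_real, hN, mul_zero] at this
  exact le_antisymm this zero_le

lemma absolutelyContinuous_of_le_image {X : ℝ → ℝ} {K : NNReal} (hX : LipschitzWith K X)
    {η μ : Measure ℝ} (hμ : μ ≪ volume) (h : ∀ B, MeasurableSet B → η B ≤ μ (X '' B)) :
    η ≪ volume := by
  refine Measure.AbsolutelyContinuous.mk fun N hN h0 => ?_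
  exact le_antisymm ((h N hN).trans (hμ (LipschitzWith.volume_image_eq_zero hX h0)).le) zero_le

/-- A Lipschitz X preserves null sets, so `η` is absolutely continuous and does not charge the
points where X is not differentiable. The area inequality on the remaining points bounds its
density. -/
lemma rnDeriv_le_of_le_image {X : ℝ → ℝ} {K : NNReal} (hX : LipschitzWith K X)
    {η μ : Measure ℝ} [IsFiniteMeasure η] [IsFiniteMeasure μ] (hμ : μ ≪ volume)
    (h : ∀ B, MeasurableSet B → η B ≤ μ (X '' B)) :
    ∀ᵐ x, η.rnDeriv volume x ≤ μ.rnDeriv volume (X x) * ENNReal.ofReal |deriv X x| := by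
  have hη := absolutelyContinuous_of_le_image hX hμ h
  refine ae_le_of_forall_setLIntegral_le_of_sigmaFinite (η.measurable_rnDeriv volume)
    fun s hs _ => ?_
  rw [Measure.setLIntegral_rnDeriv hη]
  set D := {x | DifferentiableAt ℝ X x}
  have hD : MeasurableSet D := measurableSet_of_differentiableAt ℝ X
  have hD0 : η Dᶜ = 0 := hη hX.ae_differentiableAt_real
  have hsD : η s = η (s ∩ D) := by
    refine le_antisymm ?_ (measure_mono inter_subset_left)
    rw [← measure_inter_add_sdiff s hD]
    have : η (s \ D) = 0 := measure_mono_null (fun x hx => hx.2) hD0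
    simp [this]
  rw [hsD]
  refine (h _ (hs.inter hD)).trans ?_
  conv_lhs => rw [← Measure.withDensity_rnDeriv_eq μ volume hμ]
  refine (withDensity_image_le hX.continuous.measurable (μ.measurable_rnDeriv volume)
    (hs.inter hD) fun x hx => hx.2).trans ?_
  exact lintegral_mono_set inter_subset_left

end Interpolation

/-! ### The Gaussian target -/

section Gaussian

lemma target_eq : target = volume.withDensity (gaussianPDF 0 1) :=
  gaussianReal_of_var_ne_zero 0 one_ne_zero

instance : IsProbabilityMeasure target := by unfold target; infer_instance

lemma volume_ac_target : (volume : Measure ℝ) ≪ target :=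
  gaussianReal_absolutelyContinuous' 0 one_ne_zero

lemma target_ac_volume : target ≪ (volume : Measure ℝ) :=
  gaussianReal_absolutelyContinuous 0 one_ne_zero

lemma log_gaussianPDFReal (x : ℝ) :
    Real.log (gaussianPDFReal 0 1 x) = -(x ^ 2 / 2 + Real.log √(2 * Real.pi)) := by
  rw [gaussianPDFReal, Real.log_mul (by positivity) (by positivity), Real.log_exp, Real.log_inv]
  simp
  ring

lemma llr_target_of_rnDeriv {μ : Measure ℝ} [IsFiniteMeasure μ] (hμ : μ ≪ volume) :
    ∀ᵐ x ∂μ, llr μ target x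
      = Real.log (μ.rnDeriv volume x).toReal + x ^ 2 / 2 + Real.log √(2 * Real.pi) := by
  have h := Measure.rnDeriv_withDensity_right μ volume
    (measurable_gaussianPDF 0 1).aemeasurable (ae_of_all _ fun x => (gaussianPDF_pos 0 one_ne_zero x).ne')
    (ae_of_all _ fun x => gaussianPDF_ne_top)
  rw [← target_eq] at h
  filter_upwards [hμ.ae_le h, Measure.rnDeriv_pos hμ, hμ.ae_le (μ.rnDeriv_lt_top volume)]
    with x hx hpos hlt
  have hg := gaussianPDFReal_pos 0 1 x one_ne_zero
  rw [llr_def]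
  simp only [hx, ENNReal.toReal_mul, ENNReal.toReal_inv, gaussianPDF, ENNReal.toReal_ofReal hg.le]
  rw [Real.log_mul (inv_ne_zero hg.ne') (ENNReal.toReal_pos hpos.ne' hlt.ne).ne', Real.log_inv,
    log_gaussianPDFReal]
  ring

lemma enorm_sq_lintegral_target : ∫⁻ x, ‖x‖ₑ ^ 2 ∂target < ⊤ := by
  have h := (memLp_id_gaussianReal (μ := 0) (v := 1) 2).eLpNorm_lt_top
  rw [eLpNorm_lt_top_iff_lintegral_rpow_enorm_lt_top (by simp) (by simp)] at h
  simpa [target] using h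

lemma target_mem_P2r : target ∈ P2r :=
  ⟨⟨inferInstance, enorm_sq_lintegral_target⟩, target_ac_volume⟩

end Gaussian

/-! ### Geodesic convexity and the minimizer -/

section Convexity

/-- Average log q ≤ log a + x' - 1 and log q ≤ log b + y' - 1 with weights 1-t and t: the
corrections cancel because the weighted derivatives sum to 1. Positivity of q forces all the factors
to be positive. -/
lemma log_interpolation_bound {q a b x' y' t : ℝ} (ht0 : 0 < t) (ht1 : t < 1) (hq : 0 < q)
    (hx : 0 ≤ x') (hy : 0 ≤ y') (ha : 0 ≤ a) (hb : 0 ≤ b)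
    (hqa : q ≤ a * x') (hqb : q ≤ b * y') (hsum : (1 - t) * x' + t * y' = 1) :
    Real.log q ≤ (1 - t) * Real.log a + t * Real.log b := by
  have hx' : 0 < x' := hx.lt_of_ne (by rintro rfl; simp at hqa; linarith)
  have hy' : 0 < y' := hy.lt_of_ne (by rintro rfl; simp at hqb; linarith)
  have ha' : 0 < a := ha.lt_of_ne (by rintro rfl; simp at hqa; linarith)
  have hb' : 0 < b := hb.lt_of_ne (by rintro rfl; simp at hqb; linarith)
  have h1 := Real.log_le_log hq hqa
  have h2 := Real.log_le_log hq hqb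
  rw [Real.log_mul ha'.ne' hx'.ne'] at h1
  rw [Real.log_mul hb'.ne' hy'.ne'] at h2
  have h3 := Real.log_le_sub_one_of_pos hx'
  have h4 := Real.log_le_sub_one_of_pos hy'
  have h5 : Real.log q = (1 - t) * Real.log q + t * Real.log q := by ring
  rw [h5]
  have h6 := mul_le_mul_of_nonneg_left (h1.trans (add_le_add_right h3 _)) (by linarith : 0 ≤ 1 - t)
  have h7 := mul_le_mul_of_nonneg_left (h2.trans (add_le_add_right h4 _)) ht0.le
  nlinarith

lemma energy_interpolate_le {μ ν : Measure ℝ} {γ : Measure (ℝ × ℝ)} (hμ : μ ∈ P2r) (hν : ν ∈ P2r)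
    (hγ : IsOptimalPlan μ ν γ) {t : ℝ} (ht0 : 0 < t) (ht1 : t < 1)
    (hFμ : energy μ ≠ ⊤) (hFν : energy ν ≠ ⊤) :
    energy (interpolate γ t) ≠ ⊤ ∧ (energy (interpolate γ t)).toReal
      ≤ (1 - t) * (energy μ).toReal + t * (energy ν).toReal
        - 1 / 2 * t * (1 - t) * (cost γ).toReal := by
  have : IsProbabilityMeasure μ := hμ.1.1
  have : IsProbabilityMeasure ν := hν.1.1
  have : IsProbabilityMeasure γ := isProbabilityMeasure_of_mem_plans hγ.1
  have hcost := cost_lt_top hμ.1 hν.1 hγ.1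
  have hs : 0 < 1 - t := by linarith
  obtain ⟨X, Y, hX, hY, hXY, hinv⟩ := exists_monotone_parametrization
    (Measure.nonempty_support (IsProbabilityMeasure.ne_zero γ))
    (fun z hz w hw => hγ.monotone_support hcost hz hw) ht0 ht1
  have hsupp : ∀ᵐ z ∂γ, z ∈ γ.support := Measure.support_mem_ae
  have hXl := lipschitzWith_of_monotone_of_combination hX hY hs ht0.le hXY
  have hYl := lipschitzWith_of_monotone_of_combination hY hX ht0 hs.le
    (fun u => by rw [add_comm]; exact hXY u)
  have hZm : Measurable fun z : ℝ × ℝ => (1 - t) * z.1 + t * z.2 := by fun_prop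
  set η := interpolate γ t with hη
  have : IsProbabilityMeasure η := Measure.isProbabilityMeasure_map hZm.aemeasurable
  have hXη : η.map X = μ := by
    rw [hη, interpolate, Measure.map_map hX.measurable hZm, ← hγ.1.1]
    exact Measure.map_congr (hsupp.mono fun z hz => (hinv z hz).1)
  have hYη : η.map Y = ν := by
    rw [hη, interpolate, Measure.map_map hY.measurable hZm, ← hγ.1.2]
    exact Measure.map_congr (hsupp.mono fun z hz => (hinv z hz).2)
  -- B lies in the preimage of its image; this replaces any invertibility of X.
  have hleX : ∀ B, MeasurableSet B → η B ≤ μ (X '' B) := fun B hB => by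
    rw [← hXη]
    exact (measure_mono (subset_preimage_image X B)).trans (Measure.le_map_apply hX.measurable.aemeasurable _)
  have hleY : ∀ B, MeasurableSet B → η B ≤ ν (Y '' B) := fun B hB => by
    rw [← hYη]
    exact (measure_mono (subset_preimage_image Y B)).trans (Measure.le_map_apply hY.measurable.aemeasurable _)
  have hηac := absolutelyContinuous_of_le_image hXl hμ.2 hleX
  have hlμ := klDiv_ne_top_iff.1 hFμ
  have hlν := klDiv_ne_top_iff.1 hFν
  have aeX : ∀ {P : ℝ → Prop}, (∀ᵐ x ∂μ, P x) → ∀ᵐ u ∂η, P (X u) := fun {P} h => by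
    rw [← hXη] at h
    exact ae_of_ae_map hX.measurable.aemeasurable h
  have aeY : ∀ {P : ℝ → Prop}, (∀ᵐ x ∂ν, P x) → ∀ᵐ u ∂η, P (Y u) := fun {P} h => by
    rw [← hYη] at h
    exact ae_of_ae_map hY.measurable.aemeasurable h
  let G : ℝ → ℝ := fun u => (1 - t) * llr μ target (X u) + t * llr ν target (Y u)
    - 1 / 2 * t * (1 - t) * (X u - Y u) ^ 2
  have hbound : ∀ᵐ u ∂η, llr η target u ≤ G u := by
    filter_upwards [llr_target_of_rnDeriv hηac, aeX (llr_target_of_rnDeriv hμ.2),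
      aeY (llr_target_of_rnDeriv hν.2), Measure.rnDeriv_pos hηac,
      hηac.ae_le (η.rnDeriv_lt_top volume), aeX (hμ.2.ae_le (μ.rnDeriv_lt_top volume)),
      aeY (hν.2.ae_le (ν.rnDeriv_lt_top volume)),
      hηac.ae_le (rnDeriv_le_of_le_image hXl hμ.2 hleX),
      hηac.ae_le (rnDeriv_le_of_le_image hYl hν.2 hleY),
      hηac.ae_le hXl.ae_differentiableAt_real, hηac.ae_le hYl.ae_differentiableAt_real]
      with u e1 e2 e3 hq0 hqt hpt hrt hqX hqY hdX hdY
    have hX' : 0 ≤ deriv X u := hX.deriv_nonneg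
    have hY' : 0 ≤ deriv Y u := hY.deriv_nonneg
    have hsum : (1 - t) * deriv X u + t * deriv Y u = 1 := by
      have h := ((hdX.hasDerivAt.const_mul (1 - t)).add (hdY.hasDerivAt.const_mul t))
      have h' : HasDerivAt (fun u => (1 - t) * X u + t * Y u) 1 u := by
        simp only [hXY]; exact hasDerivAt_id u
      exact h.unique h'
    have hqX' := ENNReal.toReal_mono (ENNReal.mul_ne_top hpt.ne ENNReal.ofReal_ne_top) hqX
    have hqY' := ENNReal.toReal_mono (ENNReal.mul_ne_top hrt.ne ENNReal.ofReal_ne_top) hqY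
    rw [ENNReal.toReal_mul, ENNReal.toReal_ofReal (abs_nonneg _), abs_of_nonneg hX'] at hqX'
    rw [ENNReal.toReal_mul, ENNReal.toReal_ofReal (abs_nonneg _), abs_of_nonneg hY'] at hqY'
    have hlog := log_interpolation_bound ht0 ht1 (ENNReal.toReal_pos hq0.ne' hqt.ne) hX' hY'
      ENNReal.toReal_nonneg ENNReal.toReal_nonneg hqX' hqY' hsum
    simp only [G]
    rw [e1, e2, e3]
    -- The source of the modulus: the variance identity for the quadratic potential at u = (1-t)X +
    -- tY.
    have hu : u ^ 2 = (1 - t) * X u ^ 2 + t * Y u ^ 2 - t * (1 - t) * (X u - Y u) ^ 2 := by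
      conv_lhs => rw [← hXY u]
      ring
    rw [hu]
    linarith
  have iX : Integrable (fun u => llr μ target (X u)) η := by
    have := hlμ.2
    rw [← hXη] at this ⊢
    exact this.comp_measurable hX.measurable
  have iY : Integrable (fun u => llr ν target (Y u)) η := by
    have := hlν.2
    rw [← hYη] at this ⊢
    exact this.comp_measurable hY.measurable
  have hcosteq : ∫⁻ u, ENNReal.ofReal ((X u - Y u) ^ 2) ∂η = cost γ := by
    rw [hη, interpolate, lintegral_map (f := fun u => ENNReal.ofReal ((X u - Y u) ^ 2))
      (((hX.measurable.sub hY.measurable).pow_const 2).ennreal_ofReal) hZm, cost]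
    refine lintegral_congr_ae (hsupp.mono fun z hz => ?_)
    simp only [hinv z hz, edist_sq_eq_ofReal]
  have iC : Integrable (fun u => (X u - Y u) ^ 2) η := by
    refine ⟨((hX.measurable.sub hY.measurable).pow_const 2).aestronglyMeasurable, ?_⟩
    rw [hasFiniteIntegral_iff_ofReal (ae_of_all _ fun u => sq_nonneg _), hcosteq]
    exact hcost
  have hcostint : ∫ u, (X u - Y u) ^ 2 ∂η = (cost γ).toReal := by
    rw [integral_eq_lintegral_of_nonneg_ae (ae_of_all _ fun u => sq_nonneg _)
      iC.aestronglyMeasurable, hcosteq]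
  have i12 : Integrable (fun u => (1 - t) * llr μ target (X u) + t * llr ν target (Y u)) η :=
    (iX.const_mul _).add (iY.const_mul _)
  have iG : Integrable G η := i12.sub (iC.const_mul _)
  have hηt : η ≪ target := hηac.trans volume_ac_target
  have il := integrable_llr_of_le hηt iG hbound
  refine ⟨klDiv_ne_top hηt il, ?_⟩
  have eX : ∫ u, llr μ target (X u) ∂η = (energy μ).toReal := by
    rw [energy, toReal_klDiv_eq_integral_llr hlμ.1]
    conv_rhs => rw [← hXη]
    rw [integral_map hX.measurable.aemeasurable (by
      rw [hXη]; exact (measurable_llr μ target).aestronglyMeasurable), hXη]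
  have eY : ∫ u, llr ν target (Y u) ∂η = (energy ν).toReal := by
    rw [energy, toReal_klDiv_eq_integral_llr hlν.1]
    conv_rhs => rw [← hYη]
    rw [integral_map hY.measurable.aemeasurable (by
      rw [hYη]; exact (measurable_llr ν target).aestronglyMeasurable), hYη]
  rw [energy, toReal_klDiv_eq_integral_llr hηt]
  refine (integral_mono_ae il iG hbound).trans (le_of_eq ?_)
  simp only [G]
  rw [integral_sub i12 (iC.const_mul _), integral_add (iX.const_mul _) (iY.const_mul _),
    integral_const_mul, integral_const_mul, integral_const_mul, eX, eY, hcostint]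

lemma geodesicallyConvexOn_energy : GeodesicallyConvexOn 1 energy P2r := by
  intro μ hμ ν hν
  have : IsProbabilityMeasure μ := hμ.1.1
  have : IsProbabilityMeasure ν := hν.1.1
  refine ⟨exists_isOptimalPlan, fun γ hγ t ht => ?_⟩
  have hcost := cost_lt_top hμ.1 hν.1 hγ.1
  rw [hγ.W2_sq]
  -- The endpoints are treated apart, since the parametrization divides by t and 1-t.
  rcases ht.1.eq_or_lt with rfl | ht0
  · have : interpolate γ 0 = μ := by
      rw [interpolate, ← hγ.1.1]; congr 1; funext z; simp
    simp [this]
  rcases ht.2.eq_or_lt with rfl | ht1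
  · have : interpolate γ 1 = ν := by
      rw [interpolate, ← hγ.1.2]; congr 1; funext z; simp
    simp [this]
  have hs : 0 < 1 - t := by linarith
  rw [← EReal.coe_ennreal_toReal hcost.ne, ← EReal.coe_mul]
  have hnn : ∀ {s : ℝ} (_ : 0 < s) (y : ℝ≥0∞), ((s : ℝ) : EReal) * (y : EReal) ≠ ⊥ := fun hs y =>
    (EReal.bot_lt_zero.trans_le
      (mul_nonneg (by exact_mod_cast hs.le) (EReal.coe_ennreal_nonneg y))).ne'
  by_cases hFμ : energy μ = ⊤
  · rw [hFμ, EReal.coe_ennreal_top, EReal.coe_mul_top_of_pos hs,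
      EReal.top_add_of_ne_bot (hnn ht0 _), EReal.top_sub_coe]
    exact le_top
  by_cases hFν : energy ν = ⊤
  · rw [hFν, EReal.coe_ennreal_top, EReal.coe_mul_top_of_pos ht0,
      EReal.add_top_of_ne_bot (hnn hs _), EReal.top_sub_coe]
    exact le_top
  obtain ⟨hfin, hle⟩ := energy_interpolate_le hμ hν hγ ht0 ht1 hFμ hFν
  rw [← EReal.coe_ennreal_toReal hfin, ← EReal.coe_ennreal_toReal hFμ,
    ← EReal.coe_ennreal_toReal hFν]
  exact_mod_cast hle

lemma energy_target : energy target = 0 := klDiv_self _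

lemma eq_target_of_isMinOn {μ : Measure ℝ} (hμ : μ ∈ P2r) (h : IsMinOn energy P2r μ) :
    μ = target := by
  have : IsProbabilityMeasure μ := hμ.1.1
  have h0 : energy μ ≤ energy target := h target_mem_P2r
  rw [energy_target] at h0
  exact klDiv_eq_zero_iff.1 (le_antisymm h0 zero_le)

end Convexity

/-! ### Integrability of the initial density -/

section Tails

/-- (1 + x²)² = 1 + 2x² + x⁴, and the three terms are at most 1, 4 and 24 times exp|x| by its Taylor
coefficients; 29 is their sum. -/
lemma one_add_sq_mul_exp_neg_abs_le (x : ℝ) :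
    (1 + x ^ 2) * Real.exp (-|x|) ≤ 29 * (1 + x ^ 2)⁻¹ := by
  have h2 := Real.pow_div_factorial_le_exp |x| (abs_nonneg x) 2
  have h4 := Real.pow_div_factorial_le_exp |x| (abs_nonneg x) 4
  have h0 := Real.one_le_exp (abs_nonneg x)
  rw [show |x| ^ 4 = (x ^ 2) ^ 2 by rw [← sq_abs x]; ring] at h4
  rw [sq_abs] at h2
  norm_num [Nat.factorial] at h2 h4
  rw [Real.exp_neg, ← div_eq_mul_inv, ← div_eq_mul_inv, div_le_div_iff₀ (by positivity) (by positivity)]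
  nlinarith

lemma integrable_one_add_sq_mul_exp_neg_abs :
    Integrable fun x : ℝ => (1 + x ^ 2) * Real.exp (-|x|) := by
  refine (integrable_inv_one_add_sq.const_mul 29).mono' (by fun_prop) (ae_of_all _ fun x => ?_)
  rw [Real.norm_eq_abs, abs_of_nonneg (by positivity)]
  exact one_add_sq_mul_exp_neg_abs_le x

lemma abs_sub_half_le_V0 (x : ℝ) : |x| - 1 / 2 ≤ V0 x := by
  unfold V0
  split_ifs
  · nlinarith [sq_nonneg (|x| - 1), sq_abs x]
  · exact le_rfl

lemma measurable_V0 : Measurable V0 :=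
  Measurable.ite measurableSet_Ioo (by fun_prop) (by fun_prop)

lemma integrable_exp_neg_V0 : Integrable fun x => Real.exp (-V0 x) := by
  refine (integrable_one_add_sq_mul_exp_neg_abs.const_mul (Real.exp (1 / 2))).mono'
    measurable_V0.neg.exp.aestronglyMeasurable (ae_of_all _ fun x => ?_)
  rw [Real.norm_eq_abs, Real.abs_exp]
  have h1 : Real.exp (-V0 x) ≤ Real.exp (1 / 2) * Real.exp (-|x|) := by
    rw [← Real.exp_add]
    exact Real.exp_le_exp.2 (by linarith [abs_sub_half_le_V0 x])
  refine h1.trans (mul_le_mul_of_nonneg_left ?_ (by positivity))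
  nlinarith [Real.exp_pos (-|x|), mul_nonneg (sq_nonneg x) (Real.exp_pos (-|x|)).le]

lemma D0_pos : 0 < D0 := integral_exp_pos integrable_exp_neg_V0

instance : IsProbabilityMeasure initial := by
  constructor
  have hp : ∀ x, 0 ≤ p0 x := fun x => by have := D0_pos; unfold p0; positivity
  have hi : Integrable p0 := integrable_exp_neg_V0.const_mul _
  rw [initial, withDensity_apply _ MeasurableSet.univ, Measure.restrict_univ,
    ← ofReal_integral_eq_lintegral_ofReal hi (ae_of_all _ hp)]
  simp only [p0]
  rw [integral_const_mul]
  change ENNReal.ofReal (1 / D0 * D0) = 1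
  rw [one_div_mul_cancel D0_pos.ne', ENNReal.ofReal_one]

end Tails

/-! ### The family of shapes: potential and gradient -/

section Shape

variable {a b c : ℝ}

/-- The measure with density `iterateShape a b c`. -/
noncomputable def shapeMeasure (a b c : ℝ) : Measure ℝ :=
  volume.withDensity fun x => ENNReal.ofReal (iterateShape a b c x)

lemma measurable_halfShape (a b c : ℝ) : Measurable (halfShape a b c) := by
  unfold halfShape
  exact Measurable.ite measurableSet_Iio (by fun_prop)
    (Measurable.ite measurableSet_Iio (by fun_prop) (by fun_prop))

lemma measurable_iterateShape (a b c : ℝ) : Measurable (iterateShape a b c) :=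
  Measurable.ite measurableSet_Ici (measurable_halfShape a b c)
    ((measurable_halfShape a b c).comp measurable_neg)

lemma iterateShape_eq (a b c x : ℝ) : iterateShape a b c x = halfShape a b c |x| := by
  unfold iterateShape
  split_ifs with h
  · rw [abs_of_nonneg h]
  · rw [abs_of_neg (not_le.1 h)]

lemma halfShape_nonneg (a b c x : ℝ) : 0 ≤ halfShape a b c x := by
  have := D0_pos
  unfold halfShape
  split_ifs <;> positivity

lemma iterateShape_nonneg (a b c x : ℝ) : 0 ≤ iterateShape a b c x := by
  rw [iterateShape_eq]; exact halfShape_nonneg _ _ _ _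

lemma isDensity_shapeMeasure (a b c : ℝ) : IsDensity (iterateShape a b c) (shapeMeasure a b c) :=
  ⟨measurable_iterateShape a b c, iterateShape_nonneg a b c, rfl⟩

lemma iterateShape_of_abs_lt_one {x : ℝ} (h : |x| < 1) :
    iterateShape a b c x = 1 / D0 * Real.exp (-x ^ 2 / 2) := by
  rw [iterateShape_eq, halfShape, if_pos h, sq_abs]

lemma iterateShape_of_le_abs {x : ℝ} (hc : 1 ≤ c) (h : c ≤ |x|) :
    iterateShape a b c x = Real.exp (-a * |x| + b) := by
  rw [iterateShape_eq, halfShape, if_neg (by linarith), if_neg (by linarith)]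

lemma iterateShape_of_mem {x : ℝ} (h1 : 1 ≤ |x|) (h : |x| < c) : iterateShape a b c x = 0 := by
  rw [iterateShape_eq, halfShape, if_neg (by linarith), if_pos h]

lemma iterateShape_le (ha : 1 ≤ a) (hc : 1 ≤ c) (x : ℝ) :
    iterateShape a b c x ≤ (Real.exp 1 / D0 + Real.exp b) * Real.exp (-|x|) := by
  have hD := D0_pos
  rw [add_mul]
  rcases lt_or_ge |x| 1 with h | h
  · rw [iterateShape_of_abs_lt_one h]
    have : Real.exp (-x ^ 2 / 2) ≤ Real.exp 1 * Real.exp (-|x|) := by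
      rw [← Real.exp_add]; exact Real.exp_le_exp.2 (by nlinarith [sq_nonneg x])
    have h2 : 0 ≤ Real.exp b * Real.exp (-|x|) := by positivity
    have h3 := mul_le_mul_of_nonneg_left this (by positivity : 0 ≤ 1 / D0)
    calc _ ≤ _ := h3
      _ = Real.exp 1 / D0 * Real.exp (-|x|) := by ring
      _ ≤ _ := by linarith
  · have h2 : 0 ≤ Real.exp 1 / D0 * Real.exp (-|x|) := by positivity
    have h3 : 0 ≤ Real.exp b * Real.exp (-|x|) := by positivity
    rcases lt_or_ge |x| c with h' | h'
    · rw [iterateShape_of_mem h h']; linarith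
    · rw [iterateShape_of_le_abs hc h']
      have : Real.exp (-a * |x| + b) ≤ Real.exp b * Real.exp (-|x|) := by
        rw [← Real.exp_add]; exact Real.exp_le_exp.2 (by nlinarith)
      linarith

lemma initial_eq_shapeMeasure : initial = shapeMeasure 1 (1 / 2 - Real.log D0) 1 := by
  unfold initial shapeMeasure
  congr 1
  funext x
  congr 1
  unfold p0 V0
  rcases lt_or_ge |x| 1 with h | h
  · rw [iterateShape_of_abs_lt_one h, if_pos (mem_Ioo.2 (abs_lt.1 h))]
    congr 2; ring
  · rw [iterateShape_of_le_abs le_rfl h, if_neg (by rw [mem_Ioo, ← abs_lt]; linarith),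
      show -1 * |x| + (1 / 2 - Real.log D0) = -(|x| - 1 / 2) - Real.log D0 by ring, Real.exp_sub,
      Real.exp_log D0_pos]
    ring

lemma shapeMeasure_ac (a b c : ℝ) : shapeMeasure a b c ≪ volume :=
  withDensity_absolutelyContinuous _ _

/-- The interior of the support of `iterateShape a b c`. -/
def shapeDomain (c : ℝ) : Set ℝ := {x | |x| < 1 ∨ c < |x|}

lemma isOpen_shapeDomain (c : ℝ) : IsOpen (shapeDomain c) :=
  (isOpen_lt continuous_abs continuous_const).union (isOpen_lt continuous_const continuous_abs)

lemma iterateShape_pos {x : ℝ} (hc : 1 ≤ c) (hx : x ∈ shapeDomain c) : 0 < iterateShape a b c x := by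
  have := D0_pos
  rcases hx with h | h
  · rw [iterateShape_of_abs_lt_one h]; positivity
  · rw [iterateShape_of_le_abs hc h.le]; positivity

lemma ae_shapeMeasure_iff {P : ℝ → Prop} :
    (∀ᵐ x ∂(shapeMeasure a b c), P x) ↔ ∀ᵐ x, 0 < iterateShape a b c x → P x := by
  rw [shapeMeasure, ae_withDensity_iff (measurable_iterateShape a b c).ennreal_ofReal]
  simp

lemma ae_mem_shapeDomain (a b : ℝ) (hc : 1 ≤ c) :
    ∀ᵐ x ∂(shapeMeasure a b c), x ∈ shapeDomain c := by
  have hfin : (volume : Measure ℝ) {c, -c} = 0 := (Set.toFinite _).measure_zero _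
  have : ∀ᵐ x : ℝ, x ∉ ({c, -c} : Set ℝ) := measure_eq_zero_iff_ae_notMem.1 hfin
  rw [ae_shapeMeasure_iff]
  filter_upwards [this] with x hx hpos
  by_contra hn
  simp only [shapeDomain, mem_ofPred_eq, not_or, not_lt] at hn
  rcases hn.2.lt_or_eq with h | h
  · rw [iterateShape_of_mem hn.1 h] at hpos
    exact lt_irrefl _ hpos
  · apply hx
    rcases abs_eq (by linarith : 0 ≤ c) |>.1 h with h | h <;> simp [h]

/-- The first variation of the energy at `shapeMeasure a b c`. -/
noncomputable def shapePotential (a b x : ℝ) : ℝ :=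
  (if |x| < 1 then -Real.log D0 else -a * |x| + b + x ^ 2 / 2) + Real.log √(2 * Real.pi)

/-- The Wasserstein gradient of the energy at `shapeMeasure a b c`. -/
noncomputable def shapeGradient (a x : ℝ) : ℝ :=
  if |x| < 1 then 0 else if 0 ≤ x then x - a else x + a

lemma measurable_shapePotential (a b : ℝ) : Measurable (shapePotential a b) :=
  (Measurable.ite (measurableSet_lt (by fun_prop) (by fun_prop)) (by fun_prop)
    (by fun_prop)).add_const _

lemma measurable_shapeGradient (a : ℝ) : Measurable (shapeGradient a) :=
  Measurable.ite (measurableSet_lt (by fun_prop) (by fun_prop)) (by fun_prop)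
    (Measurable.ite measurableSet_Ici (by fun_prop) (by fun_prop))

/-- On the core the Gaussian factors cancel and the potential is locally constant; on the tails it
is a quadratic. The open domain avoids the breakpoints. -/
lemma hasDerivAt_shapePotential {x : ℝ} (hc : 1 ≤ c) (hx : x ∈ shapeDomain c) :
    HasDerivAt (shapePotential a b) (shapeGradient a x) x := by
  refine HasDerivAt.add_const _ ?_
  unfold shapeGradient
  rcases hx with h | h
  · rw [if_pos h]
    refine (hasDerivAt_const x (-Real.log D0)).congr_of_eventuallyEq ?_
    filter_upwards [(isOpen_lt continuous_abs continuous_const).mem_nhds h] with y hy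
    rw [if_pos hy]
  · rw [if_neg (by linarith)]
    have hev : ∀ᶠ y in 𝓝 x, c < |y| :=
      (isOpen_lt continuous_const continuous_abs).mem_nhds h
    split_ifs with h0
    · have h0' : 0 < x := h0.lt_of_ne (by rintro rfl; simp at h; linarith)
      have hd : HasDerivAt (fun y : ℝ => -a * y + b + y ^ 2 / 2) (x - a) x := by
        have := (((hasDerivAt_id x).const_mul (-a)).add_const b).add
          (((hasDerivAt_id x).pow 2).div_const 2)
        refine this.congr_deriv ?_
        simp; ring
      refine hd.congr_of_eventuallyEq ?_
      filter_upwards [hev, lt_mem_nhds h0'] with y hy hy0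
      rw [if_neg (by linarith), abs_of_pos hy0]
    · have hd : HasDerivAt (fun y : ℝ => -a * -y + b + y ^ 2 / 2) (x + a) x := by
        have := (((hasDerivAt_id x).neg.const_mul (-a)).add_const b).add
          (((hasDerivAt_id x).pow 2).div_const 2)
        refine this.congr_deriv ?_
        simp; ring
      refine hd.congr_of_eventuallyEq ?_
      filter_upwards [hev, gt_mem_nhds (not_le.1 h0)] with y hy hy0
      rw [if_neg (by linarith), abs_of_neg hy0]

lemma log_iterateShape_add {x : ℝ} (hc : 1 ≤ c) (hx : x ∈ shapeDomain c) :
    Real.log (iterateShape a b c x) + x ^ 2 / 2 + Real.log √(2 * Real.pi)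
      = shapePotential a b x := by
  have := D0_pos
  unfold shapePotential
  rcases hx with h | h
  · rw [iterateShape_of_abs_lt_one h, if_pos h, Real.log_mul (by positivity) (by positivity),
      Real.log_exp, one_div, Real.log_inv]
    ring
  · rw [iterateShape_of_le_abs hc h.le, if_neg (by linarith), Real.log_exp]

lemma llr_shapeMeasure [IsProbabilityMeasure (shapeMeasure a b c)] (hc : 1 ≤ c) :
    shapePotential a b =ᵐ[shapeMeasure a b c] llr (shapeMeasure a b c) target := by
  have h := Measure.rnDeriv_withDensity volume (measurable_iterateShape a b c).ennreal_ofReal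
  filter_upwards [llr_target_of_rnDeriv (shapeMeasure_ac a b c), ae_mem_shapeDomain a b hc,
    (shapeMeasure_ac a b c).ae_le h] with x hx hd hr
  have hr' : (shapeMeasure a b c).rnDeriv volume x = ENNReal.ofReal (iterateShape a b c x) := hr
  rw [hx, hr', ENNReal.toReal_ofReal (iterateShape_nonneg _ _ _ _), log_iterateShape_add hc hd]

lemma integrable_shapePotential (ha : 1 ≤ a) (hc : 1 ≤ c) :
    Integrable (shapePotential a b) (shapeMeasure a b c) := by
  have hD := D0_pos
  rw [shapeMeasure, integrable_withDensity_iff (measurable_iterateShape a b c).ennreal_ofReal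
    (ae_of_all _ fun _ => ENNReal.ofReal_lt_top)]
  set M := |Real.log D0| + a + |b| + 1 + |Real.log √(2 * Real.pi)| with hM
  set K := Real.exp 1 / D0 + Real.exp b with hK
  refine (integrable_one_add_sq_mul_exp_neg_abs.const_mul (M * K)).mono'
    ((measurable_shapePotential a b).mul
      (measurable_iterateShape a b c).ennreal_ofReal.ennreal_toReal).aestronglyMeasurable
    (ae_of_all _ fun x => ?_)
  rw [ENNReal.toReal_ofReal (iterateShape_nonneg _ _ _ _), norm_mul, Real.norm_eq_abs,
    Real.norm_eq_abs, abs_of_nonneg (iterateShape_nonneg a b c x)]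
  have h1 : |shapePotential a b x| ≤ M * (1 + x ^ 2) := by
    have p1 := abs_nonneg (Real.log D0)
    have p2 := abs_nonneg b
    have p3 := abs_nonneg (Real.log √(2 * Real.pi))
    have hx2 : 2 * |x| ≤ 1 + x ^ 2 := by nlinarith [sq_nonneg (|x| - 1), sq_abs x]
    have hin : |(if |x| < 1 then -Real.log D0 else -a * |x| + b + x ^ 2 / 2)|
        ≤ (|Real.log D0| + a + |b| + 1) * (1 + x ^ 2) := by
      split_ifs
      · rw [abs_neg]
        nlinarith [sq_nonneg x, mul_nonneg p1 (sq_nonneg x), mul_nonneg p2 (sq_nonneg x)]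
      · have t1 : |-a * |x| + b + x ^ 2 / 2| ≤ a * |x| + |b| + x ^ 2 / 2 := by
          refine (abs_add_le _ _).trans (add_le_add ((abs_add_le _ _).trans ?_) ?_)
          · rw [abs_mul, abs_neg, abs_abs, abs_of_nonneg (by linarith : 0 ≤ a)]
          · rw [abs_of_nonneg (by positivity)]
        nlinarith [sq_nonneg x, mul_nonneg p1 (sq_nonneg x), mul_nonneg p2 (sq_nonneg x),
          mul_le_mul_of_nonneg_left hx2 (by linarith : 0 ≤ a)]
    have := abs_add_le (if |x| < 1 then -Real.log D0 else -a * |x| + b + x ^ 2 / 2)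
      (Real.log √(2 * Real.pi))
    unfold shapePotential
    nlinarith [mul_nonneg p3 (sq_nonneg x)]
  calc _ ≤ (M * (1 + x ^ 2)) * (K * Real.exp (-|x|)) :=
        mul_le_mul h1 (iterateShape_le ha hc x) (iterateShape_nonneg _ _ _ _)
          ((abs_nonneg _).trans h1)
    _ = _ := by ring

lemma shapeMeasure_ac_target (a b c : ℝ) : shapeMeasure a b c ≪ target :=
  (shapeMeasure_ac a b c).trans volume_ac_target

lemma integrable_llr_shapeMeasure [IsProbabilityMeasure (shapeMeasure a b c)] (ha : 1 ≤ a)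
    (hc : 1 ≤ c) : Integrable (llr (shapeMeasure a b c) target) (shapeMeasure a b c) :=
  (integrable_shapePotential ha hc).congr (llr_shapeMeasure hc)

lemma isFirstVariation_shapePotential [IsProbabilityMeasure (shapeMeasure a b c)] (ha : 1 ≤ a)
    (hc : 1 ≤ c) : IsFirstVariation energy (shapeMeasure a b c) (shapePotential a b) :=
  isFirstVariation_klDiv (shapeMeasure_ac_target a b c) (integrable_llr_shapeMeasure ha hc)
    (llr_shapeMeasure hc)

lemma isWassersteinGradient_shapeGradient [IsProbabilityMeasure (shapeMeasure a b c)] (ha : 1 ≤ a)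
    (hc : 1 ≤ c) : IsWassersteinGradient energy (shapeMeasure a b c) (shapeGradient a) :=
  ⟨(measurable_shapeGradient a).aemeasurable, shapePotential a b,
    isFirstVariation_shapePotential ha hc,
    (ae_mem_shapeDomain a b hc).mono fun _ hx => hasDerivAt_shapePotential hc hx⟩

lemma accPt_of_ae_mem {O s : Set ℝ} (hO : IsOpen O) (h : ∀ᵐ y : ℝ, y ∈ O → y ∈ s) {x : ℝ}
    (hx : x ∈ O) : AccPt x (𝓟 s) := by
  rw [accPt_iff_nhds]
  intro U hU
  have hpos : 0 < volume (U ∩ O) :=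
    Measure.measure_pos_of_mem_nhds _ (inter_mem hU (hO.mem_nhds hx))
  have hne : ∀ᵐ y : ℝ, y ≠ x := Measure.ae_ne volume x
  obtain ⟨y, hy, hys, hyx⟩ := ((frequently_ae_mem_iff.2 hpos.ne').and_eventually
    (h.and hne)).exists
  exact ⟨y, ⟨hy.1, hys hy.2⟩, hyx⟩

/-- An admissible φ agrees with the explicit potential plus a constant at almost every point of the
open domain. Every domain point is an accumulation point of this agreement set, so the derivatives
coincide wherever both exist and the values agree. -/
lemma IsWassersteinGradient.ae_eq_shapeGradient [IsProbabilityMeasure (shapeMeasure a b c)]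
    (ha : 1 ≤ a) (hc : 1 ≤ c) {v : ℝ → ℝ} (hv : IsWassersteinGradient energy (shapeMeasure a b c) v) :
    v =ᵐ[shapeMeasure a b c] shapeGradient a := by
  obtain ⟨-, φ, hφ, hd⟩ := hv
  obtain ⟨C, hC⟩ := hφ.ae_eq_add_const (isFirstVariation_shapePotential ha hc)
  have hvol : ∀ᵐ y : ℝ, y ∈ shapeDomain c → y ∈ {y | φ y = shapePotential a b y + C} :=
    (ae_shapeMeasure_iff.1 hC).mono fun y hy hyO => hy (iterateShape_pos hc hyO)
  filter_upwards [hC, hd, ae_mem_shapeDomain a b hc] with x hx hdx hxO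
  have hacc := accPt_of_ae_mem (isOpen_shapeDomain c) hvol hxO
  have h1 : HasDerivWithinAt φ (v x) {y | φ y = shapePotential a b y + C} x :=
    hdx.hasDerivWithinAt
  have h2 : HasDerivWithinAt φ (shapeGradient a x) {y | φ y = shapePotential a b y + C} x :=
    (((hasDerivAt_shapePotential hc hxO).add_const C).hasDerivWithinAt).congr
      (fun y hy => hy) hx
  exact (uniqueDiffWithinAt_iff_accPt.2 hacc).eq_deriv _ h1 h2

end Shape

/-! ### One Euler step and the sequence of iterates -/

section Step

/-- The Gaussian core of `iterateShape`. -/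
noncomputable def shapeCore (x : ℝ) : ℝ≥0∞ :=
  (Ioo (-1 : ℝ) 1).indicator (fun x => ENNReal.ofReal (1 / D0 * Real.exp (-x ^ 2 / 2))) x

/-- The right tail of `iterateShape`. -/
noncomputable def shapeTail (a b c x : ℝ) : ℝ≥0∞ :=
  (Ici c).indicator (fun x => ENNReal.ofReal (Real.exp (-a * x + b))) x

lemma measurable_shapeCore : Measurable shapeCore :=
  Measurable.indicator (by fun_prop) measurableSet_Ioo

lemma measurable_shapeTail (a b c : ℝ) : Measurable (shapeTail a b c) :=
  Measurable.indicator (by fun_prop) measurableSet_Ici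

lemma ofReal_iterateShape {a b c : ℝ} (hc : 1 ≤ c) (x : ℝ) :
    ENNReal.ofReal (iterateShape a b c x)
      = shapeCore x + shapeTail a b c x + shapeTail a b c (-x) := by
  rcases lt_or_ge |x| 1 with h | h
  · have h' := abs_lt.1 h
    have h1 : x ∈ Ioo (-1 : ℝ) 1 := h'
    have h2 : x ∉ Ici c := by simp only [mem_Ici, not_le]; linarith
    have h3 : -x ∉ Ici c := by simp only [mem_Ici, not_le]; linarith
    rw [iterateShape_of_abs_lt_one h, shapeCore, shapeTail, shapeTail,
      indicator_of_mem h1, indicator_of_notMem h2, indicator_of_notMem h3, add_zero, add_zero]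
  · have h1 : x ∉ Ioo (-1 : ℝ) 1 := fun hx => absurd (abs_lt.2 hx) (not_lt.2 h)
    rw [shapeCore, indicator_of_notMem h1, zero_add]
    rcases lt_or_ge |x| c with h' | h'
    · have h2 : x ∉ Ici c := by simp only [mem_Ici, not_le]; linarith [le_abs_self x]
      have h3 : -x ∉ Ici c := by simp only [mem_Ici, not_le]; linarith [neg_le_abs x]
      rw [iterateShape_of_mem h h', shapeTail, shapeTail, indicator_of_notMem h2,
        indicator_of_notMem h3]
      simp
    · rw [iterateShape_of_le_abs hc h']
      rcases le_total 0 x with h0 | h0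
      · rw [abs_of_nonneg h0] at h' ⊢
        have h3 : -x ∉ Ici c := by simp only [mem_Ici, not_le]; linarith
        rw [shapeTail, shapeTail, indicator_of_mem (mem_Ici.2 h'), indicator_of_notMem h3, add_zero]
      · rw [abs_of_nonpos h0] at h' ⊢
        have h3 : x ∉ Ici c := by simp only [mem_Ici, not_le]; linarith
        rw [shapeTail, shapeTail, indicator_of_notMem h3, indicator_of_mem (mem_Ici.2 h'), zero_add]

lemma map_affine_withDensity {g : ℝ → ℝ≥0∞} (hg : Measurable g) {s : ℝ} (hs : 0 < s) (d : ℝ) :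
    (volume.withDensity g).map (fun x => s * x + d)
      = volume.withDensity fun y => ENNReal.ofReal s⁻¹ * g ((y - d) / s) := by
  have hm : Measurable fun x : ℝ => s * x + d := by fun_prop
  have hvol : (volume : Measure ℝ).map (fun x => s * x + d) = ENNReal.ofReal s⁻¹ • volume := by
    have h1 := Real.map_volume_mul_left hs.ne'
    have h2 := map_add_right_eq_self (volume : Measure ℝ) d
    have : (fun x : ℝ => s * x + d) = (fun x => x + d) ∘ fun x => s * x := rfl
    rw [this, ← Measure.map_map (by fun_prop) (by fun_prop), h1, Measure.map_smul, h2,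
      abs_of_pos (inv_pos.2 hs)]
  refine Measure.ext_of_lintegral _ fun f hf => ?_
  have hg' : Measurable fun y => g ((y - d) / s) := hg.comp (by fun_prop)
  rw [lintegral_map hf hm, lintegral_withDensity_eq_lintegral_mul _ hg (g := fun x => f (s * x + d))
      (hf.comp hm),
    lintegral_withDensity_eq_lintegral_mul _ (hg'.const_mul _) hf]
  have h3 : ∫⁻ y, g ((y - d) / s) * f y ∂((volume : Measure ℝ).map fun x => s * x + d)
      = ∫⁻ x, g x * f (s * x + d) := by
    rw [lintegral_map (f := fun y => g ((y - d) / s) * f y) (hg'.mul hf) hm]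
    refine lintegral_congr fun x => ?_
    rw [add_sub_cancel_right, mul_div_cancel_left₀ _ hs.ne']
  rw [hvol, lintegral_smul_measure] at h3
  simp only [Pi.mul_apply]
  rw [← h3, smul_eq_mul, ← lintegral_const_mul (f := fun y => g ((y - d) / s) * f y) _
    (hg'.mul hf)]
  refine lintegral_congr fun y => ?_
  ring

/-- Substitute x = (y - ha)/(1-h) in exp(-ax + b) and absorb the Jacobian 1/(1-h) into the exponent
as -log(1-h). -/
lemma map_affine_shapeTail {a b c h : ℝ} (h1 : h < 1) :
    (volume.withDensity (shapeTail a b c)).map (fun x => (1 - h) * x + h * a)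
      = volume.withDensity (shapeTail (a / (1 - h))
          (b + h * a ^ 2 / (1 - h) - Real.log (1 - h)) ((1 - h) * c + h * a)) := by
  have hs : 0 < 1 - h := by linarith
  rw [map_affine_withDensity (measurable_shapeTail a b c) hs]
  congr 1
  funext y
  unfold shapeTail
  by_cases hy : (1 - h) * c + h * a ≤ y
  · have hy' : c ≤ (y - h * a) / (1 - h) := by rw [le_div_iff₀ hs]; linarith
    rw [indicator_of_mem (mem_Ici.2 hy), indicator_of_mem (mem_Ici.2 hy'),
      ← ENNReal.ofReal_mul (inv_pos.2 hs).le]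
    congr 1
    rw [← Real.exp_log (inv_pos.2 hs), Real.log_inv, ← Real.exp_add]
    congr 1
    field_simp
    ring
  · have hy' : ¬ c ≤ (y - h * a) / (1 - h) := by rw [le_div_iff₀ hs]; intro h'; apply hy; linarith
    rw [indicator_of_notMem (mt mem_Ici.1 hy), indicator_of_notMem (mt mem_Ici.1 hy'), mul_zero]

lemma withDensity_comp_neg {g : ℝ → ℝ≥0∞} (hg : Measurable g) :
    volume.withDensity (fun x => g (-x)) = (volume.withDensity g).map Neg.neg := by
  refine Measure.ext_of_lintegral _ fun f hf => ?_
  rw [lintegral_map hf measurable_neg, lintegral_withDensity_eq_lintegral_mul _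
      (f := fun x => g (-x)) (hg.comp measurable_neg) hf,
    lintegral_withDensity_eq_lintegral_mul _ hg (g := fun x => f (-x)) (hf.comp measurable_neg),
    ← lintegral_neg_eq_self]
  simp

lemma shapeMeasure_eq_add {a b c : ℝ} (hc : 1 ≤ c) :
    shapeMeasure a b c = volume.withDensity shapeCore + volume.withDensity (shapeTail a b c)
      + (volume.withDensity (shapeTail a b c)).map Neg.neg := by
  rw [← withDensity_comp_neg (measurable_shapeTail a b c), ← withDensity_add_left
    measurable_shapeCore, ← withDensity_add_left (measurable_shapeCore.add (measurable_shapeTail a b c))]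
  unfold shapeMeasure
  congr 1
  funext x
  exact ofReal_iterateShape hc x

lemma map_shapeMeasure {a b c h : ℝ} (ha : 1 ≤ a) (hc : 1 ≤ c) (h0 : 0 < h) (h1 : h < 1) :
    (shapeMeasure a b c).map (fun x => x - h * shapeGradient a x)
      = shapeMeasure (a / (1 - h)) (b + h * a ^ 2 / (1 - h) - Real.log (1 - h))
          ((1 - h) * c + h * a) := by
  -- A convex combination of c and a, both at least 1: the moved tail does not enter the core.
  have hc' : 1 ≤ (1 - h) * c + h * a := by nlinarith
  have hT : Measurable fun x => x - h * shapeGradient a x := by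
    have := measurable_shapeGradient a
    fun_prop
  rw [shapeMeasure_eq_add hc, shapeMeasure_eq_add hc', Measure.map_add _ _ hT, Measure.map_add _ _ hT,
    ← map_affine_shapeTail h1]
  have htail : ∀ᵐ x ∂(volume.withDensity (shapeTail a b c)), c ≤ x := by
    rw [ae_withDensity_iff (measurable_shapeTail a b c)]
    refine ae_of_all _ fun x hx => ?_
    by_contra hn
    exact hx (indicator_of_notMem (by simpa using hn) _)
  congr 1
  · congr 1
    · conv_rhs => rw [← Measure.map_id (μ := volume.withDensity shapeCore)]
      refine Measure.map_congr ?_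
      rw [Filter.EventuallyEq, ae_withDensity_iff measurable_shapeCore]
      refine ae_of_all _ fun x hx => ?_
      have : x ∈ Ioo (-1 : ℝ) 1 := by
        by_contra hn
        exact hx (indicator_of_notMem hn _)
      simp [shapeGradient, abs_lt.2 this]
    · refine Measure.map_congr (htail.mono fun x hx => ?_)
      have hx1 : ¬ |x| < 1 := by rw [abs_of_nonneg (by linarith)]; linarith
      simp only [shapeGradient, if_neg hx1, if_pos (by linarith : 0 ≤ x)]
      ring
  · rw [Measure.map_map hT measurable_neg, Measure.map_map measurable_neg (by fun_prop)]
    refine Measure.map_congr (htail.mono fun x hx => ?_)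
    have hx1 : ¬ |-x| < 1 := by rw [abs_neg, abs_of_nonneg (by linarith)]; linarith
    simp only [Function.comp_apply, shapeGradient, if_neg hx1, if_neg (by linarith : ¬ 0 ≤ -x)]
    ring

lemma one_le_div_one_sub {a h : ℝ} (ha : 1 ≤ a) (h0 : 0 < h) (h1 : h < 1) : 1 ≤ a / (1 - h) := by
  rw [le_div_iff₀ (by linarith)]; linarith

/-- The parameters `(a, b, c)` of the forward Euler iterates. -/
noncomputable def eulerParams (h : ℕ → ℝ) : ℕ → ℝ × ℝ × ℝ
  | 0 => (1, 1 / 2 - Real.log D0, 1)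
  | k + 1 =>
    let q := eulerParams h k
    (q.1 / (1 - h k), q.2.1 + h k * q.1 ^ 2 / (1 - h k) - Real.log (1 - h k),
      (1 - h k) * q.2.2 + h k * q.1)

/-- The explicit forward Euler iterates. -/
noncomputable def eulerMeasure (h : ℕ → ℝ) (k : ℕ) : Measure ℝ :=
  shapeMeasure (eulerParams h k).1 (eulerParams h k).2.1 (eulerParams h k).2.2

variable {h : ℕ → ℝ}

lemma eulerParams_bounds (hh : ∀ k, h k ∈ Ioo (0 : ℝ) 1) (k : ℕ) :
    1 ≤ (eulerParams h k).1 ∧ 1 ≤ (eulerParams h k).2.2 := by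
  induction k with
  | zero => simp [eulerParams]
  | succ k ih =>
    refine ⟨one_le_div_one_sub ih.1 (hh k).1 (hh k).2, ?_⟩
    simp only [eulerParams]
    nlinarith [(hh k).1, (hh k).2, ih.1, ih.2]

lemma eulerMeasure_zero : eulerMeasure h 0 = initial := initial_eq_shapeMeasure.symm

lemma map_eulerMeasure (hh : ∀ k, h k ∈ Ioo (0 : ℝ) 1) (k : ℕ) :
    (eulerMeasure h k).map (fun x => x - h k * shapeGradient (eulerParams h k).1 x)
      = eulerMeasure h (k + 1) :=
  map_shapeMeasure (eulerParams_bounds hh k).1 (eulerParams_bounds hh k).2 (hh k).1 (hh k).2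

lemma isProbabilityMeasure_eulerMeasure (hh : ∀ k, h k ∈ Ioo (0 : ℝ) 1) (k : ℕ) :
    IsProbabilityMeasure (eulerMeasure h k) := by
  induction k with
  | zero => rw [eulerMeasure_zero]; infer_instance
  | succ k ih =>
    rw [← map_eulerMeasure hh k]
    refine Measure.isProbabilityMeasure_map ?_
    have := measurable_shapeGradient (eulerParams h k).1
    fun_prop

lemma isForwardEuler_eulerMeasure (hh : ∀ k, h k ∈ Ioo (0 : ℝ) 1) :
    IsForwardEuler energy h initial (eulerMeasure h) := by
  refine ⟨eulerMeasure_zero, fun k => ⟨shapeGradient (eulerParams h k).1, ?_,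
    (map_eulerMeasure hh k).symm⟩⟩
  have : IsProbabilityMeasure (shapeMeasure (eulerParams h k).1 (eulerParams h k).2.1
    (eulerParams h k).2.2) := isProbabilityMeasure_eulerMeasure hh k
  exact isWassersteinGradient_shapeGradient (eulerParams_bounds hh k).1 (eulerParams_bounds hh k).2

/-- The scheme leaves the gradient free on null sets only, and these do not affect the push-forward.
-/
lemma IsForwardEuler.eq_eulerMeasure (hh : ∀ k, h k ∈ Ioo (0 : ℝ) 1) {ρ : ℕ → Measure ℝ}
    (hρ : IsForwardEuler energy h initial ρ) (k : ℕ) : ρ k = eulerMeasure h k := by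
  induction k with
  | zero => rw [hρ.1, eulerMeasure_zero]
  | succ k ih =>
    obtain ⟨v, hv, hk⟩ := hρ.2 k
    rw [hk, ih, ← map_eulerMeasure hh k]
    rw [ih] at hv
    have : IsProbabilityMeasure (shapeMeasure (eulerParams h k).1 (eulerParams h k).2.1
      (eulerParams h k).2.2) := isProbabilityMeasure_eulerMeasure hh k
    refine Measure.map_congr ((hv.ae_eq_shapeGradient (eulerParams_bounds hh k).1
      (eulerParams_bounds hh k).2).mono fun x hx => ?_)
    simp only [hx]

end Step

/-! ### Moving mass between two sets: cost and energy gain -/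

section Transfer

variable {ρ : Measure ℝ} {A B : Set ℝ} {ε : ℝ}

/-- The density that moves a fraction `ε` of the mass of `B` to `A`. -/
noncomputable def transferDensity (ρ : Measure ℝ) (A B : Set ℝ) (ε x : ℝ) : ℝ :=
  1 + ε * (A.indicator (fun _ => ρ.real B / ρ.real A) x - B.indicator 1 x)

lemma measurable_transferDensity (hA : MeasurableSet A) (hB : MeasurableSet B) :
    Measurable (transferDensity ρ A B ε) :=
  (((measurable_const.indicator hA).sub (measurable_one.indicator hB)).const_mul ε).const_add 1

lemma transferDensity_nonneg (hε0 : 0 ≤ ε) (hε1 : ε ≤ 1) (x : ℝ) :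
    0 ≤ transferDensity ρ A B ε x := by
  have h1 : 0 ≤ A.indicator (fun _ => ρ.real B / ρ.real A) x :=
    indicator_nonneg (fun _ _ => by positivity) x
  have h2 : B.indicator (1 : ℝ → ℝ) x ≤ 1 := indicator_le_self' (fun _ _ => zero_le_one) x
  unfold transferDensity
  nlinarith

lemma transferDensity_le (hε0 : 0 ≤ ε) (hε1 : ε ≤ 1) (x : ℝ) :
    transferDensity ρ A B ε x ≤ 1 + ρ.real B / ρ.real A := by
  have h0 : 0 ≤ ρ.real B / ρ.real A := by positivity
  have h1 : A.indicator (fun _ => ρ.real B / ρ.real A) x ≤ ρ.real B / ρ.real A :=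
    indicator_le_self' (fun _ _ => h0) x
  have h2 : 0 ≤ B.indicator (1 : ℝ → ℝ) x := indicator_nonneg (fun _ _ => zero_le_one) x
  unfold transferDensity
  nlinarith

/-- The measure obtained from `ρ` by moving a fraction `ε` of the mass of `B` to `A`. -/
noncomputable def transfer (ρ : Measure ℝ) (A B : Set ℝ) (ε : ℝ) : Measure ℝ :=
  ρ.withDensity fun x => ENNReal.ofReal (transferDensity ρ A B ε x)

/-- A transport plan from `ρ` to `transfer ρ A B ε`. -/
noncomputable def transferPlan (ρ : Measure ℝ) (A B : Set ℝ) (ε : ℝ) : Measure (ℝ × ℝ) :=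
  (ρ.withDensity fun x => ENNReal.ofReal (1 - ε * B.indicator 1 x)).map (fun x => (x, x))
    + ENNReal.ofReal (ε / ρ.real A) • (ρ.restrict B).prod (ρ.restrict A)

lemma smul_restrict_eq_withDensity (hA : MeasurableSet A) (κ : ℝ) :
    ENNReal.ofReal κ • ρ.restrict A
      = ρ.withDensity fun x => ENNReal.ofReal (A.indicator (fun _ => κ) x) := by
  have : (fun x => ENNReal.ofReal (A.indicator (fun _ => κ) x))
      = A.indicator fun _ => ENNReal.ofReal κ := by
    funext x
    by_cases hx : x ∈ A <;> simp [hx]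
  rw [this, withDensity_indicator hA, withDensity_const]

lemma one_sub_mul_indicator_nonneg (hε1 : ε ≤ 1) (x : ℝ) :
    0 ≤ 1 - ε * B.indicator (1 : ℝ → ℝ) x := by
  by_cases hx : x ∈ B <;> simp [hx, hε1]

lemma transferPlan_mem_plans [IsProbabilityMeasure ρ] (hA : MeasurableSet A) (hB : MeasurableSet B)
    (hA0 : 0 < ρ.real A) (hε0 : 0 ≤ ε) (hε1 : ε ≤ 1) :
    transferPlan ρ A B ε ∈ plans ρ (transfer ρ A B ε) := by
  have hmB : Measurable (B.indicator (1 : ℝ → ℝ)) := measurable_one.indicator hB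
  have hk : Measurable fun x => ENNReal.ofReal (1 - ε * B.indicator 1 x) := by fun_prop
  have hdiag : Measurable fun x : ℝ => (x, x) := by fun_prop
  constructor
  · rw [transferPlan, Measure.map_add _ _ measurable_fst, Measure.map_map measurable_fst hdiag,
      Measure.map_smul, Measure.map_fst_prod, smul_smul, Measure.restrict_apply_univ,
      ← ofReal_measureReal, ← ENNReal.ofReal_mul (by positivity), div_mul_cancel₀ _ hA0.ne',
      smul_restrict_eq_withDensity hB]
    have : Prod.fst ∘ (fun x : ℝ => (x, x)) = id := rfl
    rw [this, Measure.map_id, ← withDensity_add_left hk]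
    conv_rhs => rw [← withDensity_one (μ := ρ)]
    congr 1
    funext x
    simp only [Pi.add_apply, Pi.one_apply]
    rw [← ENNReal.ofReal_add (one_sub_mul_indicator_nonneg hε1 x)
      (indicator_nonneg (fun _ _ => hε0) x), ← ENNReal.ofReal_one]
    congr 1
    by_cases hx : x ∈ B <;> simp [hx]
  · rw [transferPlan, Measure.map_add _ _ measurable_snd, Measure.map_map measurable_snd hdiag,
      Measure.map_smul, Measure.map_snd_prod, smul_smul, Measure.restrict_apply_univ,
      ← ofReal_measureReal, ← ENNReal.ofReal_mul (by positivity),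
      smul_restrict_eq_withDensity hA]
    have : Prod.snd ∘ (fun x : ℝ => (x, x)) = id := rfl
    rw [this, Measure.map_id, ← withDensity_add_left hk, transfer]
    congr 1
    funext x
    simp only [Pi.add_apply]
    rw [← ENNReal.ofReal_add (one_sub_mul_indicator_nonneg hε1 x)
      (indicator_nonneg (fun _ _ => by positivity) x)]
    congr 1
    unfold transferDensity
    by_cases hx : x ∈ A
    · simp only [indicator_of_mem hx]; ring
    · simp only [indicator_of_notMem hx]; ring

/-- The diagonal part is free; the product part has mass ε ρ(B) and pays at most d per unit. -/
lemma cost_transferPlan_le [IsProbabilityMeasure ρ] (hA0 : 0 < ρ.real A)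
    (hε0 : 0 ≤ ε) {d : ℝ} (hd : ∀ x ∈ B, ∀ y ∈ A, (x - y) ^ 2 ≤ d) :
    cost (transferPlan ρ A B ε) ≤ ENNReal.ofReal (ε * ρ.real B * d) := by
  have hdiag : Measurable fun x : ℝ => (x, x) := by fun_prop
  rw [cost, transferPlan, lintegral_add_measure, lintegral_map measurable_edist_sq hdiag,
    lintegral_smul_measure, Measure.prod_restrict]
  simp only [edist_self]
  rw [zero_pow two_ne_zero, lintegral_zero, zero_add]
  have h1 : ∫⁻ z in B ×ˢ A, edist z.1 z.2 ^ 2 ∂(ρ.prod ρ) ≤ ∫⁻ _ in B ×ˢ A, ENNReal.ofReal d ∂(ρ.prod ρ) := by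
    refine setLIntegral_mono measurable_const fun z hz => ?_
    rw [edist_sq_eq_ofReal]
    exact ENNReal.ofReal_le_ofReal (hd _ hz.1 _ hz.2)
  rw [setLIntegral_const, Measure.prod_prod] at h1
  rw [smul_eq_mul]
  refine (mul_le_mul_right h1 _).trans (le_of_eq ?_)
  rw [← ofReal_measureReal, ← ofReal_measureReal, mul_comm (ENNReal.ofReal d),
    ← ENNReal.ofReal_mul (by positivity), ← mul_assoc, ← ENNReal.ofReal_mul (by positivity),
    ← ENNReal.ofReal_mul (by positivity)]
  congr 1
  field_simp

lemma integral_transferDensity_sub_one_mul [IsProbabilityMeasure ρ] (hA : MeasurableSet A)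
    (hB : MeasurableSet B) {f : ℝ → ℝ} (hf : Integrable f ρ) :
    ∫ x, (transferDensity ρ A B ε x - 1) * f x ∂ρ
      = ε * (ρ.real B / ρ.real A * ∫ x in A, f x ∂ρ - ∫ x in B, f x ∂ρ) := by
  have e : ∀ x, (transferDensity ρ A B ε x - 1) * f x
      = ε * (ρ.real B / ρ.real A * A.indicator f x - B.indicator f x) := fun x => by
    unfold transferDensity
    by_cases hx : x ∈ A <;> by_cases hy : x ∈ B <;> simp [hx, hy] <;> ring
  simp only [e]
  rw [integral_const_mul, integral_sub ((hf.indicator hA).const_mul _) (hf.indicator hB),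
    integral_const_mul, integral_indicator hA, integral_indicator hB]

lemma integral_transferDensity [IsProbabilityMeasure ρ] (hA : MeasurableSet A)
    (hB : MeasurableSet B) (hA0 : 0 < ρ.real A) (hε0 : 0 ≤ ε) (hε1 : ε ≤ 1) :
    ∫ x, transferDensity ρ A B ε x ∂ρ = 1 := by
  have h := integral_transferDensity_sub_one_mul (ε := ε) hA hB (integrable_const (μ := ρ) (1 : ℝ))
  have hint : Integrable (transferDensity ρ A B ε) ρ :=
    Integrable.of_bound (measurable_transferDensity hA hB).aestronglyMeasurable
      (1 + ρ.real B / ρ.real A) (ae_of_all _ fun x => by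
        rw [Real.norm_eq_abs, abs_of_nonneg (transferDensity_nonneg hε0 hε1 x)]
        exact transferDensity_le hε0 hε1 x)
  simp only [mul_one] at h
  rw [integral_sub hint (integrable_const _)] at h
  simp [hA0.ne'] at h
  linarith

lemma transfer_mem_P2 [IsProbabilityMeasure ρ] (hρ : ρ ∈ P2) (hA : MeasurableSet A)
    (hB : MeasurableSet B) (hA0 : 0 < ρ.real A) (hε0 : 0 ≤ ε) (hε1 : ε ≤ 1) :
    transfer ρ A B ε ∈ P2 := by
  have hm := measurable_transferDensity (ρ := ρ) (ε := ε) hA hB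
  have hint : Integrable (transferDensity ρ A B ε) ρ :=
    Integrable.of_bound hm.aestronglyMeasurable
      (1 + ρ.real B / ρ.real A) (ae_of_all _ fun x => by
        rw [Real.norm_eq_abs, abs_of_nonneg (transferDensity_nonneg hε0 hε1 x)]
        exact transferDensity_le hε0 hε1 x)
  refine ⟨isProbabilityMeasure_withDensity_ofReal (transferDensity_nonneg hε0 hε1) hint
    (integral_transferDensity hA hB hA0 hε0 hε1), ?_⟩
  rw [transfer, lintegral_withDensity_eq_lintegral_mul _ hm.ennreal_ofReal (by fun_prop)]
  refine (lintegral_mono (g := fun x => ENNReal.ofReal (1 + ρ.real B / ρ.real A) * ‖x‖ₑ ^ 2)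
    fun x => ?_).trans_lt ?_
  · simp only [Pi.mul_apply]
    gcongr
    exact transferDensity_le hε0 hε1 x
  · rw [lintegral_const_mul _ (by fun_prop)]
    exact ENNReal.mul_lt_top ENNReal.ofReal_lt_top hρ.2

/-- The linear term gains at least ερ(B)δ, since mass moves from where the log-likelihood ratio is
at least L + δ to where it is at most L. The entropic loss is at most ∫(m-1)² dρ = ε²ρ(B)(ρ(B)/ρ(A)
+ 1). -/
lemma klDiv_transfer {τ : Measure ℝ} [IsProbabilityMeasure ρ] [IsProbabilityMeasure τ] (hac : ρ ≪ τ)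
    (hint : Integrable (llr ρ τ) ρ) (hA : MeasurableSet A) (hB : MeasurableSet B)
    (hAB : Disjoint A B) (hA0 : 0 < ρ.real A) (hε0 : 0 ≤ ε) (hε1 : ε ≤ 1) {L δ : ℝ}
    (hLA : ∀ᵐ x ∂ρ, x ∈ A → llr ρ τ x ≤ L) (hLB : ∀ᵐ x ∂ρ, x ∈ B → L + δ ≤ llr ρ τ x) :
    klDiv (transfer ρ A B ε) τ ≠ ⊤ ∧
      ε * ρ.real B * (δ - ε * (ρ.real B / ρ.real A + 1))
        ≤ (klDiv ρ τ).toReal - (klDiv (transfer ρ A B ε) τ).toReal := by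
  have hm := measurable_transferDensity (ρ := ρ) (ε := ε) hA hB
  have hm0 := transferDensity_nonneg (ρ := ρ) (A := A) (B := B) hε0 hε1
  have hmC := transferDensity_le (ρ := ρ) (A := A) (B := B) hε0 hε1
  have hm1 := integral_transferDensity hA hB hA0 hε0 hε1
  obtain ⟨hfin, heq⟩ := klDiv_withDensity hac hint hm hm0 hmC hm1
  refine ⟨hfin, ?_⟩
  have hlog := (integral_mul_log_bounds hm hm0 hmC hm1).2
  have hsub := integral_transferDensity_sub_one_mul (ε := ε) hA hB hint
  have i2 : Integrable (fun x => transferDensity ρ A B ε x * llr ρ τ x) ρ :=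
    hint.bdd_mul (c := 1 + ρ.real B / ρ.real A) hm.aestronglyMeasurable (ae_of_all _ fun x => by
      rw [Real.norm_eq_abs, abs_of_nonneg (hm0 x)]; exact hmC x)
  have e1 : ∫ x, (transferDensity ρ A B ε x - 1) * llr ρ τ x ∂ρ
      = ∫ x, transferDensity ρ A B ε x * llr ρ τ x ∂ρ - ∫ x, llr ρ τ x ∂ρ := by
    rw [← integral_sub i2 hint]
    exact integral_congr_ae (ae_of_all _ fun x => by ring)
  have e2 : ∫ x, (transferDensity ρ A B ε x - 1) ^ 2 ∂ρ
      = ε ^ 2 * ρ.real B * (ρ.real B / ρ.real A + 1) := by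
    have hpt : ∀ x, (transferDensity ρ A B ε x - 1) ^ 2
        = A.indicator (fun _ => ε ^ 2 * (ρ.real B / ρ.real A) ^ 2) x
          + B.indicator (fun _ => ε ^ 2) x := fun x => by
      unfold transferDensity
      by_cases hx : x ∈ A
      · have hy : x ∉ B := disjoint_left.1 hAB hx
        simp [hx, hy]; ring
      · by_cases hy : x ∈ B <;> simp [hx, hy]
    simp only [hpt]
    rw [integral_add ((integrable_const _).indicator hA) ((integrable_const _).indicator hB),
      integral_indicator hA, integral_indicator hB, setIntegral_const, setIntegral_const,
      smul_eq_mul, smul_eq_mul]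
    field_simp
  have hA' : ∫ x in A, llr ρ τ x ∂ρ ≤ ρ.real A * L := by
    rw [← smul_eq_mul, ← setIntegral_const]
    exact setIntegral_mono_on_ae hint.integrableOn (integrable_const _).integrableOn hA hLA
  have hB' : ρ.real B * (L + δ) ≤ ∫ x in B, llr ρ τ x ∂ρ := by
    rw [← smul_eq_mul, ← setIntegral_const]
    exact setIntegral_mono_on_ae (integrable_const _).integrableOn hint.integrableOn hB hLB
  have hA'' : ρ.real B / ρ.real A * ∫ x in A, llr ρ τ x ∂ρ ≤ ρ.real B * L := by
    refine (mul_le_mul_of_nonneg_left hA' (by positivity)).trans (le_of_eq ?_)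
    field_simp
  have hcomb : ρ.real B * δ
      ≤ ∫ x in B, llr ρ τ x ∂ρ - ρ.real B / ρ.real A * ∫ x in A, llr ρ τ x ∂ρ := by linarith
  have hcomb' := mul_le_mul_of_nonneg_left hcomb hε0
  rw [toReal_klDiv_eq_integral_llr hac, transfer, heq]
  nlinarith

end Transfer

/-! ### Infinite slope at an upward jump -/

section Slope

lemma exists_le_mul_W2_of_slope_ne_top {F : Measure ℝ → ℝ≥0∞} {ρ : Measure ℝ}
    (h : slope F ρ ≠ ⊤) : ∃ K : ℝ, 0 ≤ K ∧ ∃ r : ℝ≥0∞, 0 < r ∧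
      ∀ μ ∈ P2, W2 ρ μ < r → W2 ρ μ ≠ ⊤ → F ρ ≠ ⊤ → F μ ≠ ⊤ → F μ < F ρ →
        (F ρ).toReal - (F μ).toReal ≤ K * (W2 ρ μ).toReal := by
  unfold slope at h
  have h' := lt_top_iff_ne_top.2 h
  simp only [iInf_lt_iff] at h'
  obtain ⟨r, hr, hlt⟩ := h'
  set S := ⨆ (μ : Measure ℝ) (_ : μ ∈ P2 ∧ μ ≠ ρ ∧ W2 ρ μ < r), (F ρ - F μ) / W2 ρ μ with hS
  refine ⟨S.toReal, ENNReal.toReal_nonneg, r, hr, fun μ hμ hW hWt hρ hFμ hlt' => ?_⟩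
  have hne : μ ≠ ρ := by rintro rfl; exact lt_irrefl _ hlt'
  have hle : (F ρ - F μ) / W2 ρ μ ≤ S :=
    le_iSup₂_of_le (f := fun (μ : Measure ℝ) (_ : μ ∈ P2 ∧ μ ≠ ρ ∧ W2 ρ μ < r) =>
      (F ρ - F μ) / W2 ρ μ) μ ⟨hμ, hne, hW⟩ le_rfl
  -- A positive gain divided by zero is `⊤` in `ℝ≥0∞`, contradicting the finite supremum.
  have hW0 : W2 ρ μ ≠ 0 := by
    intro h0
    rw [h0, ENNReal.div_zero (tsub_pos_of_lt hlt').ne'] at hle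
    exact absurd (hle.trans_lt hlt) (lt_irrefl _)
  rw [ENNReal.div_le_iff hW0 hWt] at hle
  have := ENNReal.toReal_mono (ENNReal.mul_ne_top hlt.ne hWt) hle
  rwa [ENNReal.toReal_mul, ENNReal.toReal_sub_of_le hlt'.le hρ] at this

lemma shapeMeasure_real_bounds {a b c : ℝ} {s : Set ℝ} (hs : MeasurableSet s)
    [IsProbabilityMeasure (shapeMeasure a b c)] {l u : ℝ}
    (hl : ∀ x ∈ s, l ≤ iterateShape a b c x) (hu : ∀ x ∈ s, iterateShape a b c x ≤ u) (hu0 : 0 ≤ u)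
    (hfin : volume s ≠ ⊤) :
    l * volume.real s ≤ (shapeMeasure a b c).real s ∧
      (shapeMeasure a b c).real s ≤ u * volume.real s := by
  have h : (shapeMeasure a b c) s = ∫⁻ x in s, ENNReal.ofReal (iterateShape a b c x) :=
    withDensity_apply _ hs
  constructor
  · rcases le_or_gt l 0 with hl0 | hl0
    · exact (mul_nonpos_of_nonpos_of_nonneg hl0 measureReal_nonneg).trans measureReal_nonneg
    have h1 : ENNReal.ofReal l * volume s ≤ (shapeMeasure a b c) s := by
      rw [h, ← setLIntegral_const]
      exact setLIntegral_mono (measurable_iterateShape a b c).ennreal_ofReal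
        fun x hx => ENNReal.ofReal_le_ofReal (hl x hx)
    have := ENNReal.toReal_mono (measure_ne_top _ _) h1
    rwa [ENNReal.toReal_mul, ENNReal.toReal_ofReal hl0.le] at this
  · have h1 : (shapeMeasure a b c) s ≤ ENNReal.ofReal u * volume s := by
      rw [h, ← setLIntegral_const]
      exact setLIntegral_mono measurable_const fun x hx => ENNReal.ofReal_le_ofReal (hu x hx)
    have := ENNReal.toReal_mono (ENNReal.mul_ne_top ENNReal.ofReal_ne_top hfin) h1
    rwa [ENNReal.toReal_mul, ENNReal.toReal_ofReal hu0] at this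

/-- Near an upward jump at `1`, mass can be moved down the jump with a gain of energy of the order
of the moved mass `ε α s`, at a cost of order `s` times its square root. -/
lemma exists_transfer_near_jump {a b : ℝ} (ha : 1 ≤ a)
    [IsProbabilityMeasure (shapeMeasure a b 1)] (hρ : shapeMeasure a b 1 ∈ P2)
    (hJ : 0 < b - a + 1 / 2 + Real.log D0) :
    ∃ κ C s₀ : ℝ, 0 < κ ∧ 0 < C ∧ 0 < s₀ ∧ ∀ s, 0 < s → s < s₀ → ∃ μ ∈ P2, ∃ M : ℝ,
      κ * s ≤ M ∧ M ≤ C * s ∧ energy μ ≠ ⊤ ∧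
      M * ((b - a + 1 / 2 + Real.log D0) / 4)
        ≤ (energy (shapeMeasure a b 1)).toReal - (energy μ).toReal ∧
      W2 (shapeMeasure a b 1) μ ^ 2 ≤ ENNReal.ofReal (M * (2 * s) ^ 2) := by
  have hD := D0_pos
  set ρ := shapeMeasure a b 1 with hρdef
  set J := b - a + 1 / 2 + Real.log D0 with hJdef
  -- α and β bound the density from below and above on both sides of 1 within distance s < 1.
  set α := min (1 / D0 * Real.exp (-1)) (Real.exp (-2 * a + b)) with hα
  set β := max (1 / D0) (Real.exp (-a + b)) with hβ
  have hα0 : 0 < α := lt_min (by positivity) (by positivity)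
  have hβ0 : 0 < β := lt_max_of_lt_left (by positivity)
  -- Small enough for the entropic loss to use at most J/4 per unit of moved mass.
  set ε := min (1 / 2) (J / (4 * (β / α + 1))) with hε
  have hε0 : 0 < ε := lt_min (by norm_num) (by positivity)
  have hε1 : ε ≤ 1 := (min_le_left _ _).trans (by norm_num)
  have hεJ : ε * (β / α + 1) ≤ J / 4 := by
    have : ε ≤ J / (4 * (β / α + 1)) := min_le_right _ _
    rw [le_div_iff₀ (by positivity)] at this
    linarith
  refine ⟨ε * α, ε * β, min 1 (J / (2 * a)), by positivity, by positivity,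
    lt_min one_pos (by positivity), fun s hs hs0 => ?_⟩
  have hs1 : s < 1 := hs0.trans_le (min_le_left _ _)
  -- Over a length s the potential on the tail drops by at most as, so it stays J/2 above its core
  -- value; J/2 - J/4 leaves the gain J/4.
  have hsJ : a * s ≤ J / 2 := by
    have : s < J / (2 * a) := hs0.trans_le (min_le_right _ _)
    rw [lt_div_iff₀ (by positivity)] at this
    linarith
  set A := Ioo (1 - s) 1 with hA
  set B := Ioo 1 (1 + s) with hB
  have hAabs : ∀ x ∈ A, |x| < 1 := fun x hx => abs_lt.2 ⟨by linarith [hx.1], hx.2⟩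
  have hBabs : ∀ x ∈ B, |x| = x := fun x hx => abs_of_pos (by linarith [hx.1])
  have hvA : volume.real A = s := by rw [hA, Real.volume_real_Ioo_of_le (by linarith)]; ring
  have hvB : volume.real B = s := by rw [hB, Real.volume_real_Ioo_of_le (by linarith)]; ring
  have bA : α * s ≤ ρ.real A ∧ ρ.real A ≤ β * s := by
    rw [← hvA]
    refine shapeMeasure_real_bounds measurableSet_Ioo (fun x hx => ?_) (fun x hx => ?_) hβ0.le
      (by simp)
    · rw [iterateShape_of_abs_lt_one (hAabs x hx)]
      refine (min_le_left _ _).trans ?_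
      gcongr
      nlinarith [sq_abs x, hAabs x hx, abs_nonneg x]
    · rw [iterateShape_of_abs_lt_one (hAabs x hx)]
      refine le_trans ?_ (le_max_left _ _)
      have : Real.exp (-x ^ 2 / 2) ≤ 1 := Real.exp_le_one_iff.2 (by nlinarith [sq_nonneg x])
      exact mul_le_of_le_one_right (by positivity) this
  have bB : α * s ≤ ρ.real B ∧ ρ.real B ≤ β * s := by
    rw [← hvB]
    refine shapeMeasure_real_bounds measurableSet_Ioo (fun x hx => ?_) (fun x hx => ?_) hβ0.le
      (by simp)
    · rw [iterateShape_of_le_abs le_rfl (by rw [hBabs x hx]; exact hx.1.le), hBabs x hx]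
      refine (min_le_right _ _).trans (Real.exp_le_exp.2 ?_)
      nlinarith [hx.2]
    · rw [iterateShape_of_le_abs le_rfl (by rw [hBabs x hx]; exact hx.1.le), hBabs x hx]
      refine le_trans (Real.exp_le_exp.2 ?_) (le_max_right _ _)
      nlinarith [hx.1]
  have hA0 : 0 < ρ.real A := lt_of_lt_of_le (by positivity) bA.1
  have hκ : ρ.real B / ρ.real A ≤ β / α := by
    rw [div_le_div_iff₀ hA0 hα0]
    nlinarith [mul_le_mul_of_nonneg_right bB.2 hα0.le, mul_le_mul_of_nonneg_left bA.1 hβ0.le]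
  have hdisj : Disjoint A B := disjoint_left.2 fun x hx hy => by linarith [hx.2, hy.1]
  have hllr := llr_shapeMeasure (a := a) (b := b) (c := 1) le_rfl
  have hkl := klDiv_transfer (ε := ε) (shapeMeasure_ac_target a b 1)
    (integrable_llr_shapeMeasure ha le_rfl) measurableSet_Ioo measurableSet_Ioo hdisj hA0 hε0.le hε1
    (L := -Real.log D0 + Real.log √(2 * Real.pi)) (δ := J / 2)
    (hllr.mono fun x hx hxA => by
      rw [← hx, shapePotential, if_pos (hAabs x hxA)])
    (hllr.mono fun x hx hxB => by
      rw [← hx, shapePotential, if_neg (by rw [hBabs x hxB]; linarith [hxB.1]), hBabs x hxB]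
      have : x ^ 2 ≥ 1 := by nlinarith [hxB.1]
      have : a * (x - 1) ≤ a * s := by gcongr; linarith [hxB.2]
      nlinarith)
  refine ⟨transfer ρ A B ε, transfer_mem_P2 hρ measurableSet_Ioo measurableSet_Ioo hA0 hε0.le hε1,
    ε * ρ.real B, ?_, ?_, hkl.1, ?_, ?_⟩
  · rw [mul_assoc]; exact mul_le_mul_of_nonneg_left bB.1 hε0.le
  · rw [mul_assoc]; exact mul_le_mul_of_nonneg_left bB.2 hε0.le
  · refine le_trans (mul_le_mul_of_nonneg_left ?_ (by positivity)) hkl.2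
    have := mul_le_mul_of_nonneg_left (add_le_add_left hκ 1) hε0.le
    linarith
  · refine (W2_sq_le_cost (transferPlan_mem_plans measurableSet_Ioo measurableSet_Ioo hA0 hε0.le
      hε1)).trans (cost_transferPlan_le hA0 hε0.le ?_)
    intro x hx y hy
    have h1 := hx.1; have h2 := hx.2; have h3 := hy.1; have h4 := hy.2
    nlinarith

/-- A finite slope would give MJ/4 ≤ K · 2s√M. Squaring and using M ≥ κs yields κ(J/4)² ≤ 4K²s,
false for small s. -/
lemma shapeMeasure_notMem_slopeDomain {a b : ℝ} (ha : 1 ≤ a)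
    [IsProbabilityMeasure (shapeMeasure a b 1)]
    (hJ : 0 < b - a + 1 / 2 + Real.log D0) : shapeMeasure a b 1 ∉ slopeDomain energy := by
  rintro ⟨hP2, hfin, hslope⟩
  obtain ⟨K, hK0, r, hr, hK⟩ := exists_le_mul_W2_of_slope_ne_top hslope
  obtain ⟨κ, C, s₀, hκ, hC, hs₀, hex⟩ := exists_transfer_near_jump ha hP2 hJ
  set J := b - a + 1 / 2 + Real.log D0
  have hsmall : ∀ᶠ s : ℝ in 𝓝[>] 0, ENNReal.ofReal (C * s * (2 * s) ^ 2) < r ^ 2 ∧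
      K ^ 2 * (4 * s) < κ * (J / 4) ^ 2 := by
    refine Filter.Eventually.and ?_ ?_
    · have : Tendsto (fun s : ℝ => ENNReal.ofReal (C * s * (2 * s) ^ 2)) (𝓝[>] 0) (𝓝 0) := by
        have h : Continuous fun s : ℝ => ENNReal.ofReal (C * s * (2 * s) ^ 2) :=
          ENNReal.continuous_ofReal.comp (by fun_prop)
        simpa using (h.tendsto 0).mono_left (nhdsWithin_le_nhds (s := Ioi 0))
      exact this.eventually_lt_const (by positivity)
    · have : Tendsto (fun s : ℝ => K ^ 2 * (4 * s)) (𝓝[>] 0) (𝓝 0) := by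
        have h : Continuous fun s : ℝ => K ^ 2 * (4 * s) := by fun_prop
        simpa using (h.tendsto 0).mono_left (nhdsWithin_le_nhds (s := Ioi 0))
      exact this.eventually_lt_const (by positivity)
  obtain ⟨s, ⟨h1, h2⟩, hs0, hs1⟩ := (hsmall.and (Ioo_mem_nhdsGT hs₀)).exists
  obtain ⟨μ, hμ, M, hM1, hM2, hFμ, hgain, hW⟩ := hex s hs0 hs1
  have hM0 : 0 < M := lt_of_lt_of_le (by positivity) hM1
  have hWr : W2 (shapeMeasure a b 1) μ < r := by
    by_contra! hle
    have hsq : W2 (shapeMeasure a b 1) μ ^ 2 < r ^ 2 :=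
      hW.trans_lt (lt_of_le_of_lt (ENNReal.ofReal_le_ofReal (by gcongr)) h1)
    exact absurd hsq (not_lt.2 (pow_le_pow_left' hle 2))
  have hWt : W2 (shapeMeasure a b 1) μ ≠ ⊤ := fun h => by simp [h] at hW
  have hlt : energy μ < energy (shapeMeasure a b 1) := by
    rw [← ENNReal.toReal_lt_toReal hFμ hfin]
    have : 0 < M * (J / 4) := by positivity
    linarith
  have hle := hgain.trans (hK μ hμ hWr hWt hfin hFμ hlt)
  have hW' := ENNReal.toReal_mono ENNReal.ofReal_ne_top hW
  rw [ENNReal.toReal_pow, ENNReal.toReal_ofReal (by positivity)] at hW'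
  have hsq : (M * (J / 4)) ^ 2 ≤ K ^ 2 * (M * (2 * s) ^ 2) := by
    calc _ ≤ (K * (W2 (shapeMeasure a b 1) μ).toReal) ^ 2 :=
          pow_le_pow_left₀ (by positivity) hle 2
      _ = K ^ 2 * (W2 (shapeMeasure a b 1) μ).toReal ^ 2 := by ring
      _ ≤ _ := mul_le_mul_of_nonneg_left hW' (sq_nonneg K)
  have hsq' : M * (J / 4) ^ 2 ≤ K ^ 2 * (4 * s ^ 2) := by
    refine le_of_mul_le_mul_left (a := M) ?_ hM0
    calc M * (M * (J / 4) ^ 2) = (M * (J / 4)) ^ 2 := by ring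
      _ ≤ _ := hsq
      _ = _ := by ring
  have hfinal : κ * (J / 4) ^ 2 ≤ K ^ 2 * (4 * s) := by
    refine le_of_mul_le_mul_left (a := s) ?_ hs0
    calc s * (κ * (J / 4) ^ 2) = (κ * s) * (J / 4) ^ 2 := by ring
      _ ≤ M * (J / 4) ^ 2 := mul_le_mul_of_nonneg_right hM1 (sq_nonneg _)
      _ ≤ _ := hsq'
      _ = _ := by ring
  exact absurd h2 (not_lt.2 hfinal)

end Slope

/-! ### One-sided limits and discontinuity of every version -/

section Jump

lemma iterateShape_neg (a b c x : ℝ) : iterateShape a b c (-x) = iterateShape a b c x := by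
  rw [iterateShape_eq, iterateShape_eq, abs_neg]

lemma tendsto_iterateShape_left (a b : ℝ) :
    Tendsto (iterateShape a b 1) (𝓝[<] 1) (𝓝 (1 / D0 * Real.exp (-1 / 2))) := by
  have h : Continuous fun x : ℝ => 1 / D0 * Real.exp (-x ^ 2 / 2) := by fun_prop
  have h1 := (h.tendsto 1).mono_left (nhdsWithin_le_nhds (s := Iio 1))
  norm_num at h1
  refine Tendsto.congr' ?_ (by norm_num; exact h1)
  filter_upwards [Ioo_mem_nhdsLT (show (-1 : ℝ) < 1 by norm_num)] with x hx
  rw [iterateShape_of_abs_lt_one (abs_lt.2 hx)]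
  ring_nf

lemma tendsto_iterateShape_right (a b : ℝ) :
    Tendsto (iterateShape a b 1) (𝓝[>] 1) (𝓝 (Real.exp (-a + b))) := by
  have h : Continuous fun x : ℝ => Real.exp (-a * x + b) := by fun_prop
  have h1 := (h.tendsto 1).mono_left (nhdsWithin_le_nhds (s := Ioi 1))
  rw [mul_one] at h1
  refine Tendsto.congr' ?_ h1
  filter_upwards [self_mem_nhdsWithin] with x hx
  have hx' : (1 : ℝ) < x := hx
  have habs : |x| = x := abs_of_pos (by linarith)
  rw [iterateShape_of_le_abs le_rfl (by rw [habs]; exact hx'.le), habs]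

lemma HasJumpAt.comp_neg {p : ℝ → ℝ} {x : ℝ} (h : HasJumpAt p x) (hp : ∀ y, p (-y) = p y) :
    HasJumpAt p (-x) := by
  obtain ⟨l, r, hl, hr, hne⟩ := h
  have hpe : p ∘ Neg.neg = p := funext hp
  refine ⟨r, l, ?_, ?_, hne.symm⟩
  · rw [← hpe]
    exact hr.comp (by simpa using tendsto_neg_nhdsLT_neg (a := x))
  · rw [← hpe]
    exact hl.comp (by simpa using tendsto_neg_nhdsGT_neg (a := x))

/-- The quantity assumed positive is the logarithm of the ratio of the right limit to the left
limit. -/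
lemma hasJumpAt_iterateShape {a b : ℝ} (hJ : 0 < b - a + 1 / 2 + Real.log D0) :
    HasJumpAt (iterateShape a b 1) 1 := by
  have hD := D0_pos
  refine ⟨_, _, tendsto_iterateShape_left a b, tendsto_iterateShape_right a b, ?_⟩
  refine ne_of_lt ?_
  rw [one_div, ← Real.exp_log (inv_pos.2 hD), Real.log_inv, ← Real.exp_add]
  exact Real.exp_lt_exp.2 (by linarith)

lemma IsDensity.ae_eq {ρ : Measure ℝ} [IsFiniteMeasure ρ] {p q : ℝ → ℝ} (hp : IsDensity p ρ)
    (hq : IsDensity q ρ) : p =ᵐ[volume] q := by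
  have h := hp.2.2.symm.trans hq.2.2
  rw [withDensity_eq_iff_of_sigmaFinite hp.1.ennreal_ofReal.aemeasurable
    hq.1.ennreal_ofReal.aemeasurable] at h
  filter_upwards [h] with x hx
  exact (ENNReal.ofReal_eq_ofReal_iff (hp.2.1 x) (hq.2.1 x)).1 hx

/-- One-sided neighbourhoods of x have positive measure, so p and q agree at points arbitrarily
close to x on each side; continuity of p would force both one-sided limits of q to equal p(x). -/
lemma HasJumpAt.not_continuousAt_of_ae_eq {p q : ℝ → ℝ} {x : ℝ} (h : HasJumpAt q x)
    (hpq : p =ᵐ[volume] q) : ¬ ContinuousAt p x := by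
  obtain ⟨l, r, hl, hr, hne⟩ := h
  intro hc
  have key : ∀ {s : Set ℝ} {y : ℝ}, MeasurableSet s → (∀ U ∈ 𝓝 x, volume (U ∩ s) ≠ 0) →
      Tendsto q (𝓝[s] x) (𝓝 y) → y = p x := fun {s y} hs hpos hy => by
    have hp : Tendsto p (𝓝[s] x) (𝓝 (p x)) := hc.mono_left nhdsWithin_le_nhds
    by_contra hyp
    obtain ⟨u, v, hu, hv, huy, hvp, huv⟩ := t2_separation hyp
    have h1 := hy (hu.mem_nhds huy)
    have h2 := hp (hv.mem_nhds hvp)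
    obtain ⟨U, hU, hUs⟩ := mem_nhdsWithin_iff_exists_mem_nhds_inter.1 (inter_mem h1 h2)
    obtain ⟨z, hz, hzeq⟩ := ((frequently_ae_mem_iff.2 (hpos U hU)).and_eventually hpq).exists
    have hz' := hUs hz
    have hzu : q z ∈ u := hz'.1
    have hzv : p z ∈ v := hz'.2
    exact disjoint_left.1 huv hzu (hzeq ▸ hzv)
  have hL : l = p x := key measurableSet_Iio (fun U hU => by
    obtain ⟨δ, hδ, hball⟩ := Metric.mem_nhds_iff.1 hU
    refine (lt_of_lt_of_le ?_ (measure_mono (?_ : Ioo (x - δ) x ⊆ _))).ne'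
    · simp [hδ]
    · intro y hy
      refine ⟨hball ?_, hy.2⟩
      rw [Real.ball_eq_Ioo]
      exact ⟨hy.1, by linarith [hy.2]⟩) hl
  have hR : r = p x := key measurableSet_Ioi (fun U hU => by
    obtain ⟨δ, hδ, hball⟩ := Metric.mem_nhds_iff.1 hU
    refine (lt_of_lt_of_le ?_ (measure_mono (?_ : Ioo x (x + δ) ⊆ _))).ne'
    · simp [hδ]
    · intro y hy
      refine ⟨hball ?_, hy.1⟩
      rw [Real.ball_eq_Ioo]
      exact ⟨by linarith [hy.1], hy.2⟩) hr
  exact hne (hL.trans hR.symm)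

end Jump

end WassersteinEuler

/-! ### The main theorem -/

open WassersteinEuler
theorem mainTheorem3 :
    -- the energy is 1-geodesically convex, with unique minimizer `N(0,1)` and minimum value 0
    (GeodesicallyConvexOn 1 energy P2r ∧
      target ∈ P2r ∧ IsMinOn energy P2r target ∧
      (∀ μ ∈ P2r, IsMinOn energy P2r μ → μ = target) ∧
      energy target = 0) ∧
    -- the forward Euler scheme, for arbitrary step sizes in (0,1)
    ∀ h : ℕ → ℝ, (∀ k, h k ∈ Set.Ioo (0 : ℝ) 1) →
      (∃ ρ : ℕ → MeasureTheory.Measure ℝ, IsForwardEuler energy h initial ρ) ∧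
      ∀ ρ : ℕ → MeasureTheory.Measure ℝ, IsForwardEuler energy h initial ρ →
        -- the first iterate is irregular
        ((∃ p : ℝ → ℝ, IsDensity p (ρ 1) ∧ HasJumpAt p 1 ∧ HasJumpAt p (-1)) ∧
          (∀ p : ℝ → ℝ, IsDensity p (ρ 1) → ¬ ContinuousAt p 1 ∧ ¬ ContinuousAt p (-1)) ∧
          ρ 1 ∉ slopeDomain energy) ∧
        -- the explicit form of all iterates
        (∀ k, ∃ a b c : ℝ, 1 ≤ a ∧ 1 ≤ c ∧ IsDensity (iterateShape a b c) (ρ k)) := by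
  refine ⟨⟨geodesicallyConvexOn_energy, target_mem_P2r, isMinOn_iff.2 fun μ _ => ?_,
    fun μ hμ hmin => eq_target_of_isMinOn hμ hmin, energy_target⟩, fun h hh => ⟨⟨eulerMeasure h,
    isForwardEuler_eulerMeasure hh⟩, fun ρ hρ => ⟨?_, fun k => ⟨(eulerParams h k).1,
      (eulerParams h k).2.1, (eulerParams h k).2.2,
      (eulerParams_bounds hh k).1, (eulerParams_bounds hh k).2, ?_⟩⟩⟩⟩
  · rw [energy_target]; exact zero_le
  · obtain ⟨h0, h1⟩ := hh 0
    have hs : 0 < 1 - h 0 := by linarith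
    -- The tail still starts at (1 - h 0) · 1 + h 0 · 1 = 1, so no gap opens in the first step.
    have hρ1 : ρ 1 = shapeMeasure (1 / (1 - h 0))
        (1 / 2 - Real.log D0 + h 0 * 1 ^ 2 / (1 - h 0) - Real.log (1 - h 0)) 1 := by
      rw [hρ.eq_eulerMeasure hh 1, eulerMeasure]
      simp only [eulerParams]
      congr 1
      ring
    have hprob : IsProbabilityMeasure (ρ 1) := by
      rw [hρ.eq_eulerMeasure hh 1]; exact isProbabilityMeasure_eulerMeasure hh 1
    -- The expression simplifies to -log(1 - h 0), the log of the compression factor of the tail.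
    have hJ : 0 < (1 / 2 - Real.log D0 + h 0 * 1 ^ 2 / (1 - h 0) - Real.log (1 - h 0))
        - 1 / (1 - h 0) + 1 / 2 + Real.log D0 := by
      have hlog := Real.log_neg hs (by linarith)
      have : h 0 * 1 ^ 2 / (1 - h 0) - 1 / (1 - h 0) = -1 := by field_simp; ring
      linarith
    rw [hρ1] at hprob ⊢
    have hj := hasJumpAt_iterateShape hJ
    have hj' := hj.comp_neg (iterateShape_neg _ _ _)
    refine ⟨⟨_, isDensity_shapeMeasure _ _ _, hj, hj'⟩, fun p hp => ?_,
      shapeMeasure_notMem_slopeDomain (one_le_div_one_sub le_rfl h0 h1) hJ⟩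
    have hae := hp.ae_eq (isDensity_shapeMeasure _ _ _)
    exact ⟨hj.not_continuousAt_of_ae_eq hae, hj'.not_continuousAt_of_ae_eq hae⟩
  · rw [hρ.eq_eulerMeasure hh k]; exact isDensity_shapeMeasure _ _ _
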